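/- **Setting.** Let $E$ be a commutative unital C*-algebra. An *$E$-C*-algebra* is a C*-algebra $F$ (not necessarily unital) with a bilinear map $E\times F\to F$, $(\alpha,x)\mapsto\alpha x$, such that $(\alpha\beta)x=\alpha(\beta x)$, $(\alpha x)^*=\alpha^*x^*$, $\|\alpha x\|\le\|\alpha\|\|x\|$, $\alpha(xy)=(\alpha x)y=x(\alpha y)$ and $1_Ex=x$. With the $E$-linear $*$-homomorphisms as morphisms these form a category $\mathfrak M_E$. Two morphisms $F\to G$ are homotopic if they are joined by a pointwise continuous path of morphisms; two objects are homotopic if there are morphisms between them, in both directions, whose two composites are homotopic to the identities; an object is *null-homotopic* if it is homotopic to $0$. Throughout, $i\in\mathbb Z/2$, and $K_0,K_1$ are covariant functors from $\mathfrak M_E$ to abelian groups, together with homomorphisms (index maps) $\delta_i:K_i(H)\to K_{i+1}(F)$ for every exact sequence $0\to F\to G\to H\to0$ in $\mathfrak M_E$, satisfying the following axioms: $K_i(0)=0$; $K_i$ carries split exact sequences to split exact sequences; homotopic morphisms induce equal maps on $K_i$; for every exact sequence the six-term sequence formed with the index maps is exact; the index maps are natural for morphisms of exact sequences. For an $E$-C*-algebra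 $F$ and a C*-algebra $G$, $F\otimes G$ is the spatial tensor product, with $\alpha(x\otimes y)=(\alpha x)\otimes y$. One writes *$G\in\Upsilon$ with $p(G)=p$, $q(G)=q$* ($p,q\in\mathbb N\cup\{0\}$) if there are group isomorphisms $\Phi_{i,G,F}:K_i(F)^{p}\times K_{i+1}(F)^{q}\to K_i(F\otimes G)$, for all $i$ and all $F$, natural in $F$. $G$ is *$\Upsilon$-null* if this holds with $p=q=0$. One writes $G\in\Upsilon_1$ if $G$ is unital and it holds with $p=1$, $q=0$, $\Phi_{i,G,F}=K_i(x\mapsto x\otimes 1_G)$. For nuclear $G\in\Upsilon$ and chosen $\Phi_{i,G,F}$, $G_\Upsilon$ is the class of exact sequences $0\to F_1\to F_2\to F_3\to 0$ in $\mathfrak M_E$ such that, $\delta_i$ and $\delta_{G,i}$ denoting the index maps of this sequence and of the (exact) sequence $0\to F_1\otimes G\to F_2\otimes G\to F_3\otimes G\to0$, one has $\delta_{G,i}\circ\Phi_{i,G,F_3}=\Phi_{i+1,G,F_1}\circ(\delta_i^{p}\times\delta_{i+1}^{q})$; if $G\in\Upsilon_1$, the chosen $\Phi_{i,G,F}$ are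 $K_i(x\mapsto x\otimes1_G)$. For a locally compact space $\Omega$ these notions are applied to $\mathcal C_0(\Omega,\mathbb C)$; one writes $\Omega\in\Upsilon$, $p(\Omega)$, $q(\Omega)$, $\Phi_{i,\Omega,F}$, and $F\otimes\mathcal C_0(\Omega,\mathbb C)$ is identified with $\mathcal C_0(\Omega,F)$. $\Omega$ is null-homotopic if $\mathcal C_0(\Omega,\mathbb C)$ is null-homotopic as a C*-algebra. **Theorem.** Let $\mathbb B_n=\{\alpha\in\mathbb R^n:\|\alpha\|\le1\}$, let $\Gamma\subset\mathbb B_n$ be closed, $\omega_0\in\Gamma$, $\Gamma'=\Gamma\setminus\{\omega_0\}$, and let $F$ be any $E$-C*-algebra. (a) $\mathbb B_n\setminus\{\omega_0\}$ is null-homotopic and $\Upsilon$-null, $\mathbb B_n\in\Upsilon_1$, and every exact sequence in $\mathfrak M_E$ belongs to $(\mathbb B_n)_\Upsilon$. (b) $K_i(\mathcal C_0(\mathbb B_n\setminus\Gamma,F))\cong K_{i+1}(\mathcal C_0(\Gamma',F))$. (c) The sequences $$0\to\mathcal C_0(\mathbb B_n\setminus\Gamma,F)\to\mathcal C(\mathbb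 B_n,F)\xrightarrow{\psi_{1,3}}\mathcal C(\Gamma,F)\to0,\qquad 0\to\mathcal C_0(\mathbb B_n\setminus\Gamma,F)\to\mathcal C_0(\mathbb B_n\setminus\{\omega_0\},F)\to\mathcal C_0(\Gamma',F)\to0$$ of inclusions and restrictions are exact; let $\delta_{1,3,i}$ and $\delta_{2,3,i}$ be their index maps, and let $\varphi:\mathcal C_0(\Gamma',F)\to\mathcal C(\Gamma,F)$ be the inclusion. Then $\delta_{2,3,i}:K_i(\mathcal C_0(\Gamma',F))\to K_{i+1}(\mathcal C_0(\mathbb B_n\setminus\Gamma,F))$ is a group isomorphism. With $\Phi_i=K_i(\varphi)\circ(\delta_{2,3,i})^{-1}$, the sequence $$0\to K_i(\mathcal C(\mathbb B_n,F))\xrightarrow{K_i(\psi_{1,3})}K_i(\mathcal C(\Gamma,F))\xrightarrow{\delta_{1,3,i}}K_{i+1}(\mathcal C_0(\mathbb B_n\setminus\Gamma,F))\to0$$ is exact, $\delta_{1,3,i}\circ\Phi_i=\mathrm{id}$, and $(a,b)\mapsto K_i(\psi_{1,3})a+\Phi_ib$ is a group isomorphism $K_i(\mathcal C(\mathbb B_n,F))\times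 K_{i+1}(\mathcal C_0(\mathbb B_n\setminus\Gamma,F))\to K_i(\mathcal C(\Gamma,F))$. (d) For all $p,q$: $\mathbb B_n\setminus\Gamma\in\Upsilon$ with $p(\mathbb B_n\setminus\Gamma)=q$, $q(\mathbb B_n\setminus\Gamma)=p$ if and only if $\Gamma'\in\Upsilon$ with $p(\Gamma')=p$, $q(\Gamma')=q$. In this case every choice of the isomorphisms $\Phi_{i,\Gamma',F}$ can be matched by a choice of the $\Phi_{i,\mathbb B_n\setminus\Gamma,F}$, and conversely, such that, up to exchanging the two factors of the domain, $\Phi_{i,\mathbb B_n\setminus\Gamma,F}=\delta_{2,3,i+1}\circ\Phi_{i+1,\Gamma',F}$. (e) Let $\Gamma$ be finite. The evaluations at points induce isomorphisms $K_i(\mathcal C_0(\Gamma',F))\cong K_i(F)^{\Gamma'}$ and $K_i(\mathcal C(\Gamma,F))\cong K_i(F)^{\Gamma}$, and the constant functions induce an isomorphism $K_i(F)\cong K_i(\mathcal C(\mathbb B_n,F))$; so $(\delta_{2,3,i})^{-1}$ becomes a group isomorphism $K_{i+1}(\mathcal C_0(\mathbb B_n\setminus\Gamma,F))\to K_i(F)^{\Gamma'}$.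 Under these identifications $$K_i(\psi_{1,3})a=(a)_{\omega\in\Gamma},\qquad \delta_{1,3,i}\big((a_\omega)_{\omega\in\Gamma}\big)=(a_\omega-a_{\omega_0})_{\omega\in\Gamma'}.$$ Moreover $\mathbb B_n\setminus\Gamma\in\Upsilon$ with $p(\mathbb B_n\setminus\Gamma)=0$, $q(\mathbb B_n\setminus\Gamma)=|\Gamma'|=|\Gamma|-1$, and with $\Phi_{i,\mathbb B_n\setminus\Gamma,F}=\delta_{2,3,i+1}\circ\Phi_{i+1,\Gamma',F}$, where $\Phi_{i,\Gamma',F}:K_i(F)^{\Gamma'}\to K_i(\mathcal C_0(\Gamma',F))$ is the inverse of the isomorphism given by the evaluations. -/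

import Mathlib

open CategoryTheory Topology Filter
open scoped TensorProduct ZeroAtInfty

universe u v w

/-- An `E`-C*-algebra: a (not necessarily unital) complex C*-algebra with an exterior multiplication
by the commutative unital C*-algebra `E`. The field `bounded` says `‖α • x‖ ≤ ‖α‖ * ‖x‖`. -/
structure ECAlg (E : Type v) [CommCStarAlgebra E] where
  carrier : Type u
  [alg : NonUnitalCStarAlgebra carrier]
  [module : Module E carrier]
  [tower : IsScalarTower ℂ E carrier]
  [mul_left : IsScalarTower E carrier carrier]
  [mul_right : SMulCommClass E carrier carrier]
  [star_smul : StarModule E carrier]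
  [bounded : IsBoundedSMul E carrier]

namespace ECAlg

variable {E : Type v} [CommCStarAlgebra E]

instance : CoeSort (ECAlg.{u} E) (Type u) := ⟨ECAlg.carrier⟩

attribute [instance] ECAlg.alg ECAlg.module ECAlg.tower ECAlg.mul_left ECAlg.mul_right
  ECAlg.star_smul ECAlg.bounded

/-- Morphisms are the `E`-linear C*-homomorphisms. -/
@[ext]
structure Hom (F G : ECAlg.{u} E) where
  toFun : F →⋆ₙₐ[ℂ] G
  map_smul : ∀ (α : E) (x : F), toFun (α • x) = α • toFun x

instance : Category (ECAlg.{u} E) where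
  Hom F G := Hom F G
  id F := ⟨NonUnitalStarAlgHom.id ℂ F, fun _ _ => rfl⟩
  comp f g := ⟨g.toFun.comp f.toFun, fun α x => by
    simp only [NonUnitalStarAlgHom.comp_apply, f.map_smul, g.map_smul]⟩

instance {F G : ECAlg.{u} E} : CoeFun (F ⟶ G) (fun _ => F → G) := ⟨fun f => Hom.toFun f⟩

/-- `0 → F → G → H → 0` is exact. -/
structure ShortExact {F G H : ECAlg.{u} E} (φ : F ⟶ G) (ψ : G ⟶ H) : Prop where
  injective : Function.Injective φ
  exact : ∀ y : G, ψ y = 0 ↔ ∃ x : F, φ x = y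
  surjective : Function.Surjective ψ

/-- Two morphisms are homotopic if they are joined by a pointwise continuous path of morphisms. -/
def Homotopic {F G : ECAlg.{u} E} (φ ψ : F ⟶ G) : Prop :=
  ∃ h : unitInterval → (F ⟶ G), h 0 = φ ∧ h 1 = ψ ∧ ∀ x : F, Continuous fun s => h s x

/-- Homotopy of `E`-C*-algebras. -/
def HomotopyEquivalent (F G : ECAlg.{u} E) : Prop :=
  ∃ (φ : F ⟶ G) (ψ : G ⟶ F), Homotopic (φ ≫ ψ) (𝟙 F) ∧ Homotopic (ψ ≫ φ) (𝟙 G)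

/-- `F` is null-homotopic if it is homotopic to the one-element `E`-C*-algebra `0`. -/
def NullHomotopic (F : ECAlg.{u} E) : Prop :=
  ∃ Z : ECAlg.{u} E, Subsingleton Z ∧ HomotopyEquivalent F Z

end ECAlg

open ECAlg

/-- A K-theory on the category of `E`-C*-algebras: two covariant functors into abelian groups,
indexed by `ℤ/2`, and index maps for the short exact sequences, subject to the null axiom, the
split exact axiom, the homotopy axiom, the six-term axiom and the commutativity of the index maps.
The index `j = i + 1` of the target of an index map is carried by an equation, so that the
identity `i + 1 + 1 = i` of `ℤ/2` needs no transport. -/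
structure KTheory (E : Type v) [CommCStarAlgebra E] where
  functor : ZMod 2 → ECAlg.{u} E ⥤ AddCommGrpCat.{w}
  null : ∀ (i : ZMod 2) (Z : ECAlg.{u} E), Subsingleton Z → Subsingleton ((functor i).obj Z)
  split_exact : ∀ (i : ZMod 2) {F G H : ECAlg.{u} E} (φ : F ⟶ G) (ψ : G ⟶ H) (l : H ⟶ G),
    ShortExact φ ψ → l ≫ ψ = 𝟙 H →
      Function.Injective ((functor i).map φ) ∧
      (∀ b, (functor i).map ψ b = 0 ↔ ∃ a, (functor i).map φ a = b) ∧
      (∀ c, (functor i).map ψ ((functor i).map l c) = c)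
  homotopy : ∀ (i : ZMod 2) {F G : ECAlg.{u} E} (φ ψ : F ⟶ G), Homotopic φ ψ →
    (functor i).map φ = (functor i).map ψ
  index : ∀ {F G H : ECAlg.{u} E} {φ : F ⟶ G} {ψ : G ⟶ H}, ShortExact φ ψ →
    ∀ {i j : ZMod 2}, j = i + 1 → ((functor i).obj H →+ (functor j).obj F)
  exact_middle : ∀ {F G H : ECAlg.{u} E} {φ : F ⟶ G} {ψ : G ⟶ H}, ShortExact φ ψ →
    ∀ (i : ZMod 2) (b : (functor i).obj G),
      (functor i).map ψ b = 0 ↔ ∃ a, (functor i).map φ a = b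
  exact_right : ∀ {F G H : ECAlg.{u} E} {φ : F ⟶ G} {ψ : G ⟶ H} (h : ShortExact φ ψ)
    {i j : ZMod 2} (hij : j = i + 1) (c : (functor i).obj H),
      index h hij c = 0 ↔ ∃ b, (functor i).map ψ b = c
  exact_left : ∀ {F G H : ECAlg.{u} E} {φ : F ⟶ G} {ψ : G ⟶ H} (h : ShortExact φ ψ)
    {i j : ZMod 2} (hij : j = i + 1) (a : (functor j).obj F),
      (functor j).map φ a = 0 ↔ ∃ c, index h hij c = a
  index_natural : ∀ {F G H F' G' H' : ECAlg.{u} E} {φ : F ⟶ G} {ψ : G ⟶ H}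
    {φ' : F' ⟶ G'} {ψ' : G' ⟶ H'} (h : ShortExact φ ψ) (h' : ShortExact φ' ψ')
    (f₁ : F ⟶ F') (f₂ : G ⟶ G') (f₃ : H ⟶ H'), φ ≫ f₂ = f₁ ≫ φ' → ψ ≫ f₃ = f₂ ≫ ψ' →
    ∀ {i j : ZMod 2} (hij : j = i + 1) (c : (functor i).obj H),
      (functor j).map f₁ (index h hij c) = index h' hij ((functor i).map f₃ c)

namespace KTheory

variable {E : Type v} [CommCStarAlgebra E] (𝒦 : KTheory.{u, v, w} E)

/-- The group `K_i(F)`. -/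
abbrev K (i : ZMod 2) (F : ECAlg.{u} E) : Type w := (𝒦.functor i).obj F

/-- The homomorphism `K_i(φ)`. -/
abbrev map (i : ZMod 2) {F G : ECAlg.{u} E} (φ : F ⟶ G) : 𝒦.K i F →+ 𝒦.K i G :=
  ((𝒦.functor i).map φ).hom

end KTheory

/-- Positive linear functionals. -/
def IsPositiveFunctional {A : Type*} [NonUnitalCStarAlgebra A] (f : A →ₗ[ℂ] ℂ) : Prop :=
  ∀ x : A, ∃ r : ℝ, 0 ≤ r ∧ f (star x * x) = r

/-- The functional `x ⊗ y ↦ f x * g y` on the algebraic tensor product. -/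
noncomputable def tensorFunctional {A B : Type*} [NonUnitalCStarAlgebra A] [NonUnitalCStarAlgebra B]
    (f : A →ₗ[ℂ] ℂ) (g : B →ₗ[ℂ] ℂ) : A ⊗[ℂ] B →ₗ[ℂ] ℂ :=
  LinearMap.mul' ℂ ℂ ∘ₗ TensorProduct.map f g

/-- The values `‖(π_f ⊗ π_g)(z) ξ‖²`, where `π_f`, `π_g` are the GNS representations of positive
functionals `f`, `g`, and where `ξ` is the vector of norm at most `1` given by an element `w` of the
algebraic tensor product: `‖ξ‖² = (f ⊗ g)(w* w)` and `‖(π_f ⊗ π_g)(z) ξ‖² = (f ⊗ g)(w* z* z w)`.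
Their supremum is the square of the spatial norm of `z`. -/
def spatialValues {A B : Type*} [NonUnitalCStarAlgebra A] [NonUnitalCStarAlgebra B]
    (z : A ⊗[ℂ] B) : Set ℝ :=
  {r | ∃ (f : A →ₗ[ℂ] ℂ) (g : B →ₗ[ℂ] ℂ) (w : A ⊗[ℂ] B),
    IsPositiveFunctional f ∧ IsPositiveFunctional g ∧
    (tensorFunctional f g (star w * w)).re ≤ 1 ∧
    (tensorFunctional f g (star w * (star z * z) * w)).re = r}

variable {E : Type v} [CommCStarAlgebra E]

/-- The spatial tensor product `F ⊗ G` of an `E`-C*-algebra and a C*-algebra: the completion of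
the algebraic tensor product in the spatial norm, with `α • (x ⊗ y) = (α • x) ⊗ y`. -/
structure SpatialTensor (F : ECAlg.{u} E) (G : Type) [NonUnitalCStarAlgebra G] where
  obj : ECAlg.{u} E
  tmul : F ⊗[ℂ] G →ₗ[ℂ] obj
  map_mul : ∀ z w, tmul (z * w) = tmul z * tmul w
  map_star : ∀ z, tmul (star z) = star (tmul z)
  smul_tmul : ∀ (α : E) (x : F) (y : G), α • tmul (x ⊗ₜ y) = tmul ((α • x) ⊗ₜ y)
  dense : DenseRange tmul
  norm_sq : ∀ z, IsLUB (spatialValues z) (‖tmul z‖ ^ 2)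

namespace SpatialTensor

variable {G : Type} [NonUnitalCStarAlgebra G]

/-- `θ` is the morphism `φ ⊗ id_G`. -/
def IsMap {F F' : ECAlg.{u} E} (T : SpatialTensor F G) (T' : SpatialTensor F' G) (φ : F ⟶ F')
    (θ : T.obj ⟶ T'.obj) : Prop :=
  ∀ (x : F) (y : G), θ (T.tmul (x ⊗ₜ y)) = T'.tmul (φ x ⊗ₜ y)

/-- The morphism `F ⟶ F ⊗ G`, `x ↦ x ⊗ e`, for a unit `e` of `G`. -/
def inclOne {F : ECAlg.{u} E} (T : SpatialTensor F G) (e : G) (he : ∀ y : G, e * y = y ∧ y * e = y) :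
    F ⟶ T.obj :=
  { toFun :=
      { toFun := fun x => T.tmul (x ⊗ₜ e)
        map_smul' := fun c x => by
          rw [← TensorProduct.smul_tmul', T.tmul.map_smul]; rfl
        map_zero' := by simp
        map_add' := fun x y => by simp [TensorProduct.add_tmul]
        map_mul' := fun x y => by
          rw [← T.map_mul, Algebra.TensorProduct.tmul_mul_tmul, (he e).1]
        map_star' := fun x => by
          have h : star e = e := by
            have h1 := (he (star e)).1
            have h2 := congrArg star h1
            rw [star_mul, star_star] at h2
            rw [← h1, h2]
          rw [← T.map_star, TensorProduct.star_tmul, h] }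
    map_smul := fun α x => (T.smul_tmul α x e).symm }

end SpatialTensor

namespace KTheory

variable (𝒦 : KTheory.{u, v, w} E)

/-- A family of group isomorphisms `Φ_{i,G,F} : K_i(F)^p × K_{i+1}(F)^q ≅ K_i(F ⊗ G)`, natural in
`F`, as in the definition of the class `Υ`. -/
structure UpsilonFamily (G : Type) [NonUnitalCStarAlgebra G] (p q : ℕ) where
  iso : ∀ {i j : ZMod 2}, j = i + 1 → ∀ {F : ECAlg.{u} E} (T : SpatialTensor F G),
    ((Fin p → 𝒦.K i F) × (Fin q → 𝒦.K j F)) ≃+ 𝒦.K i T.obj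
  natural : ∀ {i j : ZMod 2} (hij : j = i + 1) {F F' : ECAlg.{u} E} (T : SpatialTensor F G)
    (T' : SpatialTensor F' G) (φ : F ⟶ F') (θ : T.obj ⟶ T'.obj), T.IsMap T' φ θ →
    ∀ (a : Fin p → 𝒦.K i F) (b : Fin q → 𝒦.K j F),
      𝒦.map i θ (iso hij T (a, b)) =
        iso hij T' (fun k => 𝒦.map i φ (a k), fun k => 𝒦.map j φ (b k))

/-- `G ∈ Υ` with `p(G) = p` and `q(G) = q`. -/
def InUpsilon (G : Type) [NonUnitalCStarAlgebra G] (p q : ℕ) : Prop :=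
  Nonempty (𝒦.UpsilonFamily G p q)

/-- `G` is `Υ`-null. -/
def UpsilonNull (G : Type) [NonUnitalCStarAlgebra G] : Prop :=
  𝒦.InUpsilon G 0 0

/-- The family `Φ` consists of the maps `K_i(x ↦ x ⊗ 1_G)`. -/
def UpsilonFamily.IsInclOne {𝒦 : KTheory.{u, v, w} E} {G : Type} [NonUnitalCStarAlgebra G]
    (Φ : 𝒦.UpsilonFamily G 1 0) (e : G) (he : ∀ y : G, e * y = y ∧ y * e = y) : Prop :=
  ∀ {i j : ZMod 2} (hij : j = i + 1) {F : ECAlg.{u} E} (T : SpatialTensor F G)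
    (a : Fin 1 → 𝒦.K i F) (b : Fin 0 → 𝒦.K j F),
      Φ.iso hij T (a, b) = 𝒦.map i (T.inclOne e he) (a 0)

/-- `G ∈ Υ₁`: `G` is unital and `K_i(x ↦ x ⊗ 1_G)` are isomorphisms `K_i(F) ≅ K_i(F ⊗ G)`. -/
def InUpsilonOne (G : Type) [NonUnitalCStarAlgebra G] : Prop :=
  ∃ (e : G) (he : ∀ y : G, e * y = y ∧ y * e = y) (Φ : 𝒦.UpsilonFamily G 1 0), Φ.IsInclOne e he

/-- The short exact sequence `0 → F₁ → F₂ → F₃ → 0` belongs to `G_Υ`, for nuclear `G`: its tensor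
product with `G` is exact, and the isomorphisms `Φ` commute with the index maps. -/
def UpsilonFamily.Compatible {𝒦 : KTheory.{u, v, w} E} {G : Type} [NonUnitalCStarAlgebra G]
    {p q : ℕ} (Φ : 𝒦.UpsilonFamily G p q) {F₁ F₂ F₃ : ECAlg.{u} E} {φ₁ : F₁ ⟶ F₂} {φ₂ : F₂ ⟶ F₃}
    (h : ShortExact φ₁ φ₂) : Prop :=
  ∀ (T₁ : SpatialTensor F₁ G) (T₂ : SpatialTensor F₂ G) (T₃ : SpatialTensor F₃ G)
    (θ₁ : T₁.obj ⟶ T₂.obj) (θ₂ : T₂.obj ⟶ T₃.obj), T₁.IsMap T₂ φ₁ θ₁ → T₂.IsMap T₃ φ₂ θ₂ →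
    ∃ hT : ShortExact θ₁ θ₂, ∀ {i j : ZMod 2} (hij : j = i + 1) (hji : i = j + 1)
      (a : Fin p → 𝒦.K i F₃) (b : Fin q → 𝒦.K j F₃),
      𝒦.index hT hij (Φ.iso hij T₃ (a, b)) =
        Φ.iso hji T₁ (fun k => 𝒦.index h hij (a k), fun k => 𝒦.index h hji (b k))

end KTheory

/-- The `E`-C*-algebra `C₀(Ω, F)`, with the pointwise exterior multiplication. For compact `Ω` it is
`C(Ω, F)`. -/
noncomputable def C0 (Ω : Type) [TopologicalSpace Ω] (F : ECAlg.{u} E) : ECAlg.{u} E where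
  carrier := C₀(Ω, F)
  tower := ⟨fun c α f => ZeroAtInftyContinuousMap.ext fun ω => smul_assoc c α (f ω)⟩
  bounded := IsBoundedSMul.of_norm_smul_le fun α f => by
    refine (BoundedContinuousFunction.norm_le (by positivity)).2 fun ω => ?_
    refine (norm_smul_le α (f ω)).trans ?_
    gcongr
    exact f.toBCF.norm_coe_le_norm ω

/-- Elements of `C₀(Ω, F)` are functions on `Ω`. -/
instance {Ω : Type} [TopologicalSpace Ω] {F : ECAlg.{u} E} : CoeFun (C0 Ω F) (fun _ => Ω → F) :=
  ⟨fun f => (show C₀(Ω, F) from f)⟩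

namespace C0

section

variable {X : Type} [TopologicalSpace X]

open Classical in
/-- Extension by zero of a function `C₀(S, F)` to `T`, for an open subset `S` of `T`. -/
noncomputable def extendFun [T2Space X] {S T : Set X} (hST : S ⊆ T)
    (hS : IsOpen ((↑) ⁻¹' S : Set T)) {A : Type*} [NormedAddCommGroup A] (f : C₀(S, A)) :
    C₀(T, A) :=
  have key : ∀ ε > 0, ∃ C : Set T, IsCompact C ∧ C ⊆ (↑) ⁻¹' S ∧
      ∀ t ∉ C, ‖(if h : (t : X) ∈ S then f ⟨t, h⟩ else 0)‖ < ε := by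
    intro ε hε
    obtain ⟨C, hC, hCf⟩ := Filter.mem_cocompact.1
      ((zero_at_infty f).eventually (Metric.ball_mem_nhds (0 : A) hε))
    refine ⟨Set.inclusion hST '' C, hC.image (continuous_inclusion hST), ?_, fun t ht => ?_⟩
    · rintro _ ⟨s, -, rfl⟩
      exact s.2
    · split_ifs with h
      · have h1 : (⟨t, h⟩ : S) ∉ C := fun hc => ht ⟨_, hc, rfl⟩
        simpa using hCf h1
      · simpa using hε
  { toFun := fun t => if h : (t : X) ∈ S then f ⟨t, h⟩ else 0
    continuous_toFun := by
      rw [continuous_iff_continuousAt]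
      intro t
      by_cases ht : (t : X) ∈ S
      · have h2 : ContinuousOn (fun t : T => if h : (t : X) ∈ S then f ⟨t, h⟩ else 0)
            ((↑) ⁻¹' S : Set T) := by
          rw [continuousOn_iff_continuous_domRestrict]
          have h3 : (((↑) ⁻¹' S : Set T).domRestrict
              (fun t : T => if h : (t : X) ∈ S then f ⟨t, h⟩ else 0)) =
              fun t => f ⟨t.1.1, t.2⟩ := by
            ext t
            exact dif_pos t.2
          rw [h3]
          exact (map_continuous f).comp (by fun_prop)
        exact h2.continuousAt (hS.mem_nhds ht)
      · rw [Metric.continuousAt_iff']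
        intro ε hε
        obtain ⟨C, hC, hCS, hCf⟩ := key ε hε
        filter_upwards [hC.isClosed.isOpen_compl.mem_nhds (fun h => ht (hCS h))] with s hs
        rw [dif_neg ht, dist_zero_right]
        exact hCf s hs
    zero_at_infty' := by
      rw [Metric.tendsto_nhds]
      intro ε hε
      obtain ⟨C, hC, -, hCf⟩ := key ε hε
      refine Filter.mem_cocompact.2 ⟨C, hC, fun t ht => ?_⟩
      simpa using hCf t ht }

open Classical in
/-- The inclusion `C₀(S, F) ⟶ C₀(T, F)` for an open subset `S` of `T`: extension by zero. -/
noncomputable def extend [T2Space X] {S T : Set X} (hST : S ⊆ T)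
    (hS : IsOpen ((↑) ⁻¹' S : Set T)) (F : ECAlg.{u} E) : C0 S F ⟶ C0 T F where
  toFun :=
    { toFun := fun f => extendFun hST hS (show C₀(S, F) from f)
      map_smul' := fun c f => ZeroAtInftyContinuousMap.ext fun t => by
        change (if h : (t : X) ∈ S then c • f ⟨t, h⟩ else 0) =
          c • (if h : (t : X) ∈ S then f ⟨t, h⟩ else 0)
        split_ifs <;> simp
      map_zero' := ZeroAtInftyContinuousMap.ext fun t => by
        change (if h : (t : X) ∈ S then (0 : F) else 0) = 0
        split_ifs <;> simp
      map_add' := fun f g => ZeroAtInftyContinuousMap.ext fun t => by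
        change (if h : (t : X) ∈ S then f ⟨t, h⟩ + g ⟨t, h⟩ else 0) =
          (if h : (t : X) ∈ S then f ⟨t, h⟩ else 0) + (if h : (t : X) ∈ S then g ⟨t, h⟩ else 0)
        split_ifs <;> simp
      map_mul' := fun f g => ZeroAtInftyContinuousMap.ext fun t => by
        change (if h : (t : X) ∈ S then f ⟨t, h⟩ * g ⟨t, h⟩ else 0) =
          (if h : (t : X) ∈ S then f ⟨t, h⟩ else 0) * (if h : (t : X) ∈ S then g ⟨t, h⟩ else 0)
        split_ifs <;> simp
      map_star' := fun f => ZeroAtInftyContinuousMap.ext fun t => by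
        change (if h : (t : X) ∈ S then star (f ⟨t, h⟩) else 0) =
          star (if h : (t : X) ∈ S then f ⟨t, h⟩ else 0)
        split_ifs <;> simp }
  map_smul := fun α f => ZeroAtInftyContinuousMap.ext fun t => by
    change (if h : (t : X) ∈ S then α • f ⟨t, h⟩ else 0) =
      α • (if h : (t : X) ∈ S then f ⟨t, h⟩ else 0)
    split_ifs <;> simp

/-- The restriction `C₀(T, F) ⟶ C₀(S, F)` to a closed subset `S` of `T`. -/
noncomputable def restrict {S T : Set X} (hST : S ⊆ T) (hS : IsClosed ((↑) ⁻¹' S : Set T))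
    (F : ECAlg.{u} E) : C0 T F ⟶ C0 S F where
  toFun :=
    { toFun := fun f => ZeroAtInftyContinuousMap.comp (show C₀(T, F) from f)
        { toFun := Set.inclusion hST
          continuous_toFun := continuous_inclusion hST
          cocompact_tendsto' := (Topology.IsClosedEmbedding.inclusion hST hS).tendsto_cocompact }
      map_smul' := fun _ _ => rfl
      map_zero' := rfl
      map_add' := fun _ _ => rfl
      map_mul' := fun _ _ => rfl
      map_star' := fun _ => rfl }
  map_smul := fun _ _ => rfl

/-- The evaluation `C₀(Ω, F) ⟶ F` at a point. -/
noncomputable def eval {Ω : Type} [TopologicalSpace Ω] (ω : Ω) (F : ECAlg.{u} E) : C0 Ω F ⟶ F where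
  toFun :=
    { toFun := fun f => f ω
      map_smul' := fun _ _ => rfl
      map_zero' := rfl
      map_add' := fun _ _ => rfl
      map_mul' := fun _ _ => rfl
      map_star' := fun _ => rfl }
  map_smul := fun _ _ => rfl

/-- The constant functions, `F ⟶ C(T, F)`, for a compact set `T`. -/
noncomputable def const {T : Set X} (hT : IsCompact T) (F : ECAlg.{u} E) : F ⟶ C0 T F where
  toFun :=
    { toFun := fun x =>
        { toFun := fun _ => x
          continuous_toFun := continuous_const
          zero_at_infty' := by
            have := isCompact_iff_compactSpace.1 hT
            simp }
      map_smul' := fun _ _ => rfl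
      map_zero' := rfl
      map_add' := fun _ _ => rfl
      map_mul' := fun _ _ => rfl
      map_star' := fun _ => rfl }
  map_smul := fun _ _ => rfl

end

end C0

/-- A norm-one functional with value `1` at the unit is positive. -/
theorem isPositiveFunctional_of_norm_le {A : Type*} [CStarAlgebra A] (f : StrongDual ℂ A)
    (hf : ‖f‖ ≤ 1) (h1 : f 1 = 1) : IsPositiveFunctional (f : A →ₗ[ℂ] ℂ) := by
  intro x
  let _ := CStarAlgebra.spectralOrder A
  have _ := CStarAlgebra.spectralOrderedRing A
  set y := star x * x with hy
  have hsa : IsSelfAdjoint y := IsSelfAdjoint.star_mul_self x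
  have hle : ∀ a : A, ‖f a‖ ≤ ‖a‖ := fun a => by
    simpa using (f.le_opNorm a).trans (mul_le_mul_of_nonneg_right hf (norm_nonneg a))
  have him : (f y).im = 0 := by
    have key : ∀ t : ℝ, ((f y).im + t) ^ 2 ≤ ‖y‖ ^ 2 + t ^ 2 := by
      intro t
      have e1 : f (y + ((t : ℂ) * Complex.I) • 1) = f y + (t : ℂ) * Complex.I := by
        simp [h1]
      have e2 : ‖y + ((t : ℂ) * Complex.I) • (1 : A)‖ ^ 2 ≤ ‖y‖ ^ 2 + t ^ 2 := by
        rw [pow_two, ← CStarRing.norm_star_mul_self]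
        have e3 : star (y + ((t : ℂ) * Complex.I) • (1 : A)) * (y + ((t : ℂ) * Complex.I) • 1) =
            y * y + ((t ^ 2 : ℝ) : ℂ) • 1 := by
          have hI : (t : ℂ) * Complex.I * (t * Complex.I) = -((t : ℂ) ^ 2) := by
            linear_combination (t : ℂ) ^ 2 * Complex.I_mul_I
          simp [hsa.star_eq, add_mul, mul_add, smul_smul, hI]
        rw [e3]
        refine (norm_add_le _ _).trans (add_le_add ?_ ?_)
        · rw [pow_two]; exact norm_mul_le y y
        · rw [norm_smul]
          refine (mul_le_of_le_one_right (norm_nonneg _) ?_).trans ?_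
          · rcases subsingleton_or_nontrivial A with hA | hA
            · simp [Subsingleton.elim (1 : A) 0]
            · simp
          · simp
      have e4 := hle (y + ((t : ℂ) * Complex.I) • 1)
      rw [e1] at e4
      have e5 : ((f y).im + t) ^ 2 ≤ ‖f y + (t : ℂ) * Complex.I‖ ^ 2 := by
        have := Complex.abs_im_le_norm (f y + (t : ℂ) * Complex.I)
        have h2 : (f y + (t : ℂ) * Complex.I).im = (f y).im + t := by simp
        rw [h2] at this
        rw [← sq_abs]
        gcongr
      nlinarith [norm_nonneg (f y + (t : ℂ) * Complex.I)]
    by_contra h0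
    have := key (‖y‖ ^ 2 / (f y).im)
    have h3 : ‖y‖ ^ 2 / (f y).im * (f y).im = ‖y‖ ^ 2 := div_mul_cancel₀ _ h0
    have h4 : 0 < (f y).im ^ 2 := by positivity
    nlinarith [sq_nonneg ‖y‖]
  have hre : 0 ≤ (f y).re := by
    have hs : ‖algebraMap ℝ A ‖y‖ - y‖ ≤ ‖y‖ := by
      have := (SpectrumRestricts.nnreal_iff_nnnorm (t := ‖y‖₊) hsa le_rfl).1
        (CStarAlgebra.spectralOrder A |> fun _ => SpectrumRestricts.nnreal_of_nonneg (star_mul_self_nonneg x))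
      exact this
    have h2 := (hle _).trans hs
    have h3 : f (algebraMap ℝ A ‖y‖ - y) = (‖y‖ : ℂ) - f y := by
      rw [map_sub]
      congr 1
      rw [Algebra.algebraMap_eq_smul_one]
      have : (‖y‖ : ℝ) • (1 : A) = (‖y‖ : ℂ) • (1 : A) := by simp
      rw [this, map_smul, h1]; simp
    rw [h3] at h2
    have h4 := (Complex.re_le_norm _).trans h2
    simp at h4
    linarith
  exact ⟨(f y).re, hre, Complex.ext (by simp [hy]) (by simpa using him)⟩

theorem exists_state {A : Type*} [CStarAlgebra A] [Nontrivial A] (h : A) (hh : IsSelfAdjoint h) :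
    ∃ f : A →ₗ[ℂ] ℂ, IsPositiveFunctional f ∧ ∃ z : ℂ, ‖z‖ = ‖h‖ ∧ f h = z ∧
      f (h * h) = z ^ 2 ∧ f (h * h * h) = z ^ 3 := by
  have : IsStarNormal h := hh.isStarNormal
  let B := StarAlgebra.elemental ℂ h
  let k : B := ⟨h, StarAlgebra.elemental.self_mem ℂ h⟩
  have hk : IsSelfAdjoint k := Subtype.ext hh
  obtain ⟨z, hz, hzn⟩ := spectrum.exists_nnnorm_eq_spectralRadius k
  rw [hk.spectralRadius_eq_nnnorm] at hzn
  obtain ⟨χ, hχ⟩ := WeakDual.CharacterSpace.mem_spectrum_iff_exists.1 hz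
  let χ' : StrongDual ℂ B := WeakDual.toStrongDual (χ : WeakDual ℂ B)
  have hχn : ‖χ'‖ ≤ 1 := WeakDual.CharacterSpace.norm_le_norm_one χ |>.trans (by simp)
  obtain ⟨g, hg, hgn⟩ := exists_extension_norm_eq (Subalgebra.toSubmodule B.toSubalgebra) χ'
  have hgB : ∀ b : B, g (b : A) = χ b := fun b => hg b
  refine ⟨g, isPositiveFunctional_of_norm_le g (hgn.trans_le hχn) ?_, z, ?_, ?_, ?_, ?_⟩
  · simpa using hgB 1
  · have : ‖z‖₊ = ‖k‖₊ := by exact_mod_cast hzn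
    exact congrArg NNReal.toReal this
  · simpa [hχ] using hgB k
  · simpa [hχ, pow_two] using hgB (k * k)
  · simpa [hχ, pow_succ] using hgB (k * k * k)

theorem exists_norming {A : Type*} [NonUnitalCStarAlgebra A] (a : A) :
    ∃ (f : A →ₗ[ℂ] ℂ) (w : A), IsPositiveFunctional f ∧ (f (star w * w)).re ≤ 1 ∧
      ‖a‖ ^ 2 ≤ (f (star w * (star a * a) * w)).re := by
  let h : A := star a * a
  have hh : IsSelfAdjoint h := IsSelfAdjoint.star_mul_self a
  rcases eq_or_ne a 0 with rfl | ha
  · exact ⟨0, 0, fun x => ⟨0, le_rfl, by simp⟩, by simp, by simp⟩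
  have hc : ‖h‖ = ‖a‖ ^ 2 := by rw [pow_two]; exact CStarRing.norm_star_mul_self
  have hc0 : 0 < ‖a‖ := norm_pos_iff.2 ha
  obtain ⟨f, hf, z, hz, hz1, hz2, hz3⟩ := exists_state (A := Unitization ℂ A) (h : Unitization ℂ A)
    (hh.inr ℂ)
  obtain ⟨r, hr, hr'⟩ := hf (a : Unitization ℂ A)
  have hzr : z = r := by rw [← hz1, ← hr']; simp [h]
  have hrc : r = ‖a‖ ^ 2 := by
    rw [Unitization.norm_inr, hc, hzr] at hz
    simpa [abs_of_nonneg hr] using hz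
  let F : A →ₗ[ℂ] ℂ := f ∘ₗ (Unitization.inrHom ℂ ℂ A)
  have hF : ∀ x, F x = f (x : Unitization ℂ A) := fun x => rfl
  let w : A := ((r⁻¹ : ℝ) : ℂ) • h
  have hr0 : (r : ℂ) ≠ 0 := by
    rw [hrc]; exact_mod_cast (by positivity : ‖a‖ ^ 2 ≠ 0)
  have hs : star w = w := by simp [w, hh.star_eq]
  refine ⟨F, w, fun x => ?_, ?_, ?_⟩
  · obtain ⟨s, hs, hs'⟩ := hf (x : Unitization ℂ A)
    exact ⟨s, hs, by rw [hF, ← hs']; simp⟩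
  · have : F (star w * w) = 1 := by
      rw [hs, hF]
      simp only [w, smul_mul_smul_comm, Unitization.inr_smul, Unitization.inr_mul, map_smul, hz2, hzr]
      simp only [smul_eq_mul, Complex.ofReal_inv]
      field_simp
    rw [this]; simp
  · have : F (star w * (star a * a) * w) = r := by
      rw [hs, hF]
      change f (((w * h * w : A)) : Unitization ℂ A) = r
      simp only [w, smul_mul_assoc, mul_smul_comm, Unitization.inr_smul, Unitization.inr_mul,
        map_smul, hz3, hzr]
      simp only [smul_eq_mul, Complex.ofReal_inv]
      field_simp
    rw [this, hrc]; exact_mod_cast le_rfl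

section Realization

variable (Ω : Type) [TopologicalSpace Ω] (A : Type u) [NonUnitalCStarAlgebra A]

/-- The linear map `A ⊗ C₀(Ω, ℂ) → C₀(Ω, A)` with `x ⊗ g ↦ (ω ↦ g ω • x)`. -/
noncomputable def C0.tmulFun : A ⊗[ℂ] C₀(Ω, ℂ) →ₗ[ℂ] C₀(Ω, A) :=
  TensorProduct.lift (LinearMap.mk₂ ℂ
    (fun (x : A) (g : C₀(Ω, ℂ)) =>
      { toFun := fun ω => g ω • x
        continuous_toFun := by fun_prop
        zero_at_infty' := by simpa using (zero_at_infty g).smul_const x })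
    (fun x y g => ZeroAtInftyContinuousMap.ext fun ω => smul_add (g ω) x y)
    (fun c x g => ZeroAtInftyContinuousMap.ext fun ω => smul_comm (g ω) c x)
    (fun x g h => ZeroAtInftyContinuousMap.ext fun ω => add_smul (g ω) (h ω) x)
    (fun c x g => ZeroAtInftyContinuousMap.ext fun ω => smul_assoc c (g ω) x))

variable {Ω A}

theorem C0.tmulFun_tmul (x : A) (g : C₀(Ω, ℂ)) (ω : Ω) : C0.tmulFun Ω A (x ⊗ₜ g) ω = g ω • x := rfl

theorem C0.tmulFun_mul (z w : A ⊗[ℂ] C₀(Ω, ℂ)) :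
    C0.tmulFun Ω A (z * w) = C0.tmulFun Ω A z * C0.tmulFun Ω A w := by
  have h1 : ∀ {B D : Type _} [NonUnitalCStarAlgebra B] [NonUnitalCStarAlgebra D]
      (x y z : B ⊗[ℂ] D), (x + y) * z = x * z + y * z ∧ z * (x + y) = z * x + z * y ∧
        0 * z = 0 ∧ z * 0 = 0 :=
    fun x y z => ⟨add_mul x y z, mul_add z x y, zero_mul z, mul_zero z⟩
  induction z using TensorProduct.induction_on with
  | zero => rw [(h1 0 0 w).2.2.1, map_zero, zero_mul]
  | add a b ha hb => rw [(h1 a b w).1, map_add, ha, hb, map_add, add_mul]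
  | tmul x g =>
    induction w using TensorProduct.induction_on with
    | zero => rw [(h1 0 0 (x ⊗ₜ g)).2.2.2, map_zero, mul_zero]
    | add a b ha hb => rw [(h1 a b (x ⊗ₜ g)).2.1, map_add, ha, hb, map_add, mul_add]
    | tmul y h =>
      rw [Algebra.TensorProduct.tmul_mul_tmul]
      ext ω
      simp [C0.tmulFun_tmul, smul_mul_smul_comm]

theorem C0.tmulFun_star (z : A ⊗[ℂ] C₀(Ω, ℂ)) :
    C0.tmulFun Ω A (star z) = star (C0.tmulFun Ω A z) := by
  induction z using TensorProduct.induction_on with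
  | zero => simp
  | add a b ha hb => rw [star_add, map_add, ha, hb, map_add, star_add]
  | tmul x g =>
    rw [TensorProduct.star_tmul]
    ext ω
    simp [C0.tmulFun_tmul]

theorem C0.tmulFun_dense : DenseRange (C0.tmulFun Ω A) := by
  intro f
  rw [Metric.mem_closure_range_iff]
  intro ε' hε'
  obtain ⟨ε, hε, hεε⟩ := exists_between hε'
  obtain ⟨C, hC, hCf⟩ := Filter.mem_cocompact.1
    ((zero_at_infty f).eventually (Metric.ball_mem_nhds (0 : A) hε))
  have hK : IsCompact (f '' C ∩ {v | ε ≤ ‖v‖}) :=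
    (hC.image (map_continuous f)).inter_right (isClosed_le continuous_const continuous_norm)
  obtain ⟨t, htK, htf, hcov⟩ := hK.finite_cover_balls (half_pos hε)
  obtain ⟨t, rfl⟩ := htf.exists_finset_coe
  let bump : A → A → ℝ := fun x v => max 0 (ε - ‖v - x‖)
  let s : A → ℝ := fun v => ∑ x ∈ t, bump x v
  let q : A → A → ℝ := fun x v => bump x v / max (s v) (ε / 2)
  have hpos : ∀ v, 0 < max (s v) (ε / 2) := fun v => lt_max_of_lt_right (half_pos hε)
  have hbc : ∀ x, Continuous (bump x) := fun x => by fun_prop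
  have hqc : ∀ x, Continuous (q x) := fun x =>
    (hbc x).div ((continuous_finsetSum t fun x _ => hbc x).max continuous_const)
      fun v => (hpos v).ne'
  have hq0 : ∀ x ∈ t, q x 0 = 0 := by
    intro x hx
    have h1 : ε ≤ ‖x‖ := (htK hx).2
    simp only [q, bump, zero_sub, norm_neg]
    rw [max_eq_left (by linarith), zero_div]
  have hqn : ∀ x v, 0 ≤ q x v := fun x v => div_nonneg (le_max_left _ _) (hpos v).le
  classical
  let g : A → C₀(Ω, ℂ) := fun x => if hx : x ∈ t then
    { toFun := fun ω => ((q x (f ω) : ℝ) : ℂ)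
      continuous_toFun := Complex.continuous_ofReal.comp ((hqc x).comp (map_continuous f))
      zero_at_infty' := by
        have h1 := ((Complex.continuous_ofReal.comp (hqc x)).tendsto 0).comp (zero_at_infty f)
        simpa [hq0 x hx] using! h1 } else 0
  have hg : ∀ x ∈ t, ∀ ω, g x ω = ((q x (f ω) : ℝ) : ℂ) := by
    intro x hx ω
    simp only [g, dif_pos hx]
    rfl
  refine ⟨∑ x ∈ t, x ⊗ₜ g x, lt_of_le_of_lt ?_ hεε⟩
  rw [dist_eq_norm]
  refine (BoundedContinuousFunction.norm_le hε.le).2 fun ω => ?_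
  change ‖f ω - (C0.tmulFun Ω A (∑ x ∈ t, x ⊗ₜ g x)) ω‖ ≤ ε
  set v := f ω with hv
  have e1 : (C0.tmulFun Ω A (∑ x ∈ t, x ⊗ₜ g x)) ω = ∑ x ∈ t, q x v • x := by
    rw [map_sum]
    have h2 : ∀ (u : Finset A) (F : A → C₀(Ω, A)), (∑ x ∈ u, F x) ω = ∑ x ∈ u, F x ω := by
      intro u F
      induction u using Finset.induction_on with
      | empty => rfl
      | insert a u ha ih =>
        rw [Finset.sum_insert ha, Finset.sum_insert ha, ← ih]; rfl
    rw [h2]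
    refine Finset.sum_congr rfl fun x hx => ?_
    rw [C0.tmulFun_tmul, hg x hx, ← hv]
    exact Complex.coe_smul _ _
  have e2 : ∑ x ∈ t, q x v = s v / max (s v) (ε / 2) := by
    simp only [q, ← Finset.sum_div, s]
  set Q := ∑ x ∈ t, q x v with hQ
  have hQ1 : Q ≤ 1 := by
    rw [e2]; exact div_le_one_of_le₀ (le_max_left _ _) (hpos v).le
  have e3 : v - ∑ x ∈ t, q x v • x = (1 - Q) • v + ∑ x ∈ t, q x v • (v - x) := by
    simp only [smul_sub, Finset.sum_sub_distrib, ← Finset.sum_smul, ← hQ, sub_smul, one_smul]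
    abel
  have e4 : ∀ x ∈ t, ‖q x v • (v - x)‖ ≤ q x v * ε := by
    intro x _
    rw [norm_smul, Real.norm_of_nonneg (hqn x v)]
    by_cases h : ‖v - x‖ ≤ ε
    · exact mul_le_mul_of_nonneg_left h (hqn x v)
    · have : q x v = 0 := by
        simp only [q, bump]
        rw [max_eq_left (by linarith), zero_div]
      simp [this]
  have e5 : (1 - Q) * ‖v‖ ≤ (1 - Q) * ε := by
    by_cases h : ‖v‖ ≤ ε
    · exact mul_le_mul_of_nonneg_left h (by linarith)
    · have hvK : v ∈ f '' C ∩ {v | ε ≤ ‖v‖} := by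
        refine ⟨⟨ω, ?_, rfl⟩, (not_le.1 h).le⟩
        by_contra hω
        have h1 := hCf hω
        replace h1 : dist (f ω) 0 < ε := h1
        rw [dist_zero_right] at h1
        exact h h1.le
      have h2 := hcov hvK
      simp only [Set.mem_iUnion, Metric.mem_ball, dist_eq_norm] at h2
      obtain ⟨x, hx, hxv⟩ := h2
      have h3 : ε / 2 ≤ s v := by
        have h4 : bump x v ≤ s v :=
          Finset.single_le_sum (f := fun x => bump x v) (fun _ _ => le_max_left _ _) hx
        have h5 : ε - ‖v - x‖ ≤ bump x v := le_max_right _ _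
        linarith
      have : Q = 1 := by
        rw [e2, max_eq_left h3]; exact div_self (by linarith)
      simp [this]
  rw [e1, e3]
  calc ‖(1 - Q) • v + ∑ x ∈ t, q x v • (v - x)‖
      ≤ (1 - Q) * ‖v‖ + ∑ x ∈ t, q x v * ε := by
        refine (norm_add_le _ _).trans (add_le_add ?_ ?_)
        · rw [norm_smul, Real.norm_of_nonneg (by linarith)]
        · exact (norm_sum_le _ _).trans (Finset.sum_le_sum e4)
    _ ≤ (1 - Q) * ε + Q * ε := by rw [← Finset.sum_mul]; linarith
    _ = ε := by ring

theorem C0.tensorFunctional_eq (f : A →ₗ[ℂ] ℂ) : ∃ S : A ⊗[ℂ] C₀(Ω, ℂ) →ₗ[ℂ] C₀(Ω, ℂ),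
    (∀ z ω, S z ω = f (C0.tmulFun Ω A z ω)) ∧ ∀ (g : C₀(Ω, ℂ) →ₗ[ℂ] ℂ) z,
      tensorFunctional f g z = g (S z) := by
  refine ⟨TensorProduct.lift (LinearMap.lsmul ℂ C₀(Ω, ℂ) ∘ₗ f), fun z ω => ?_, fun g z => ?_⟩
  · induction z using TensorProduct.induction_on with
    | zero => simp
    | add a b ha hb =>
      rw [map_add, map_add, ZeroAtInftyContinuousMap.add_apply, ha, hb,
        ZeroAtInftyContinuousMap.add_apply, map_add]
    | tmul x h => simp [C0.tmulFun_tmul, mul_comm]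
  · induction z using TensorProduct.induction_on with
    | zero => simp
    | add a b ha hb => rw [map_add, map_add, ha, hb, map_add]
    | tmul x h => simp [tensorFunctional]

theorem C0.tmulFun_norm_sq (z : A ⊗[ℂ] C₀(Ω, ℂ)) :
    IsLUB (spatialValues z) (‖C0.tmulFun Ω A z‖ ^ 2) := by
  let _ := CStarAlgebra.spectralOrder A
  have _ := CStarAlgebra.spectralOrderedRing A
  constructor
  · rintro r ⟨f, g, w, hf, hg, hw, rfl⟩
    obtain ⟨S, hS, hSg⟩ := C0.tensorFunctional_eq (Ω := Ω) f
    set c := ‖C0.tmulFun Ω A z‖ with hc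
    let P : C₀(Ω, ℂ) := ((c ^ 2 : ℝ) : ℂ) • S (star w * w) - S (star w * (star z * z) * w)
    have hP : ∀ ω, ∃ s : ℝ, 0 ≤ s ∧ P ω = s := by
      intro ω
      set W := C0.tmulFun Ω A w ω with hW
      set Z := C0.tmulFun Ω A z ω with hZ
      have hZc : ‖Z‖ ≤ c := (C0.tmulFun Ω A z).toBCF.norm_coe_le_norm ω
      have e1 : P ω = f (((c ^ 2 : ℝ) : ℂ) • (star W * W) - star W * (star Z * Z) * W) := by
        simp only [P, ZeroAtInftyContinuousMap.sub_apply, ZeroAtInftyContinuousMap.smul_apply, hS,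
          C0.tmulFun_mul, C0.tmulFun_star, map_sub, map_smul]
        rfl
      have e2 : 0 ≤ ((c ^ 2 : ℝ) : ℂ) • (star W * W) - star W * (star Z * Z) * W := by
        rw [sub_nonneg]
        refine (CStarAlgebra.star_left_conjugate_le_norm_smul
          (IsSelfAdjoint.star_mul_self Z)).trans ?_
        rw [CStarRing.norm_star_mul_self, Complex.coe_smul]
        refine smul_le_smul_of_nonneg_right ?_ (star_mul_self_nonneg W)
        rw [pow_two]
        exact mul_self_le_mul_self (norm_nonneg Z) hZc
      obtain ⟨b, hb⟩ := CStarAlgebra.nonneg_iff_eq_star_mul_self.1 e2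
      obtain ⟨s, hs, hs'⟩ := hf b
      exact ⟨s, hs, by rw [e1, hb, hs']⟩
    let q : C₀(Ω, ℂ) :=
      { toFun := fun ω => ((Real.sqrt (P ω).re : ℝ) : ℂ)
        continuous_toFun := by fun_prop
        zero_at_infty' := by
          have h1 : Continuous fun x : ℂ => ((Real.sqrt x.re : ℝ) : ℂ) := by fun_prop
          simpa using! (h1.tendsto 0).comp (zero_at_infty P) }
    have hq : P = star q * q := by
      ext ω
      obtain ⟨s, hs, hs'⟩ := hP ω
      have h1 : q ω = ((Real.sqrt s : ℝ) : ℂ) := by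
        change ((Real.sqrt (P ω).re : ℝ) : ℂ) = _
        rw [hs']; simp
      rw [ZeroAtInftyContinuousMap.mul_apply, ZeroAtInftyContinuousMap.star_apply, h1, hs']
      simp [← Complex.ofReal_mul, Real.mul_self_sqrt hs]
    obtain ⟨s, hs, hs'⟩ := hg q
    rw [← hq] at hs'
    simp only [P, map_sub, map_smul, ← hSg] at hs'
    have h2 := congrArg Complex.re hs'
    simp only [Complex.sub_re, smul_eq_mul, Complex.re_ofReal_mul, Complex.ofReal_re] at h2
    nlinarith [sq_nonneg c]
  · intro b hb
    have hb0 : 0 ≤ b := hb ⟨0, 0, 0, fun x => ⟨0, le_rfl, by simp⟩, fun x => ⟨0, le_rfl, by simp⟩,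
      by simp [tensorFunctional], by simp [tensorFunctional]⟩
    suffices h : ‖C0.tmulFun Ω A z‖ ≤ Real.sqrt b by
      calc _ ≤ Real.sqrt b ^ 2 := by gcongr
        _ = b := Real.sq_sqrt hb0
    refine (BoundedContinuousFunction.norm_le (Real.sqrt_nonneg b)).2 fun ω => ?_
    change ‖C0.tmulFun Ω A z ω‖ ≤ _
    refine Real.le_sqrt_of_sq_le ?_
    set k := C0.tmulFun Ω A z ω with hk
    rcases eq_or_ne k 0 with h0 | h0
    · simpa [h0] using hb0
    obtain ⟨f, w, hf, hw, hfw⟩ := exists_norming k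
    obtain ⟨S, hS, hSg⟩ := C0.tensorFunctional_eq (Ω := Ω) f
    let p : C₀(Ω, ℂ) :=
      { toFun := fun ω' => ((‖C0.tmulFun Ω A z ω'‖ / ‖k‖ : ℝ) : ℂ)
        continuous_toFun := by fun_prop
        zero_at_infty' := by
          have h1 : Continuous fun x : A => ((‖x‖ / ‖k‖ : ℝ) : ℂ) := by fun_prop
          simpa using! (h1.tendsto 0).comp (zero_at_infty (C0.tmulFun Ω A z)) }
    have hp : C0.tmulFun Ω A (w ⊗ₜ p) ω = w := by
      have h1 : p ω = 1 := by
        change ((‖k‖ / ‖k‖ : ℝ) : ℂ) = 1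
        rw [div_self (norm_ne_zero_iff.2 h0)]; simp
      rw [C0.tmulFun_tmul, h1, one_smul]
    let g : C₀(Ω, ℂ) →ₗ[ℂ] ℂ :=
      { toFun := fun h => h ω
        map_add' := fun _ _ => rfl
        map_smul' := fun _ _ => rfl }
    have hgS : ∀ y, tensorFunctional f g y = f (C0.tmulFun Ω A y ω) := fun y => by
      rw [hSg]; exact hS y ω
    refine hfw.trans (hb ⟨f, g, w ⊗ₜ p, hf, fun h => ⟨‖h ω‖ ^ 2, by positivity, ?_⟩, ?_, ?_⟩)
    · change star (h ω) * h ω = _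
      have := Complex.conj_mul' (h ω)
      simpa using this
    · rw [hgS, C0.tmulFun_mul, C0.tmulFun_star, ZeroAtInftyContinuousMap.mul_apply,
        ZeroAtInftyContinuousMap.star_apply, hp]
      exact hw
    · rw [hgS]
      simp only [C0.tmulFun_mul, C0.tmulFun_star, ZeroAtInftyContinuousMap.mul_apply,
        ZeroAtInftyContinuousMap.star_apply, hp, ← hk]

end Realization

/-- The identification of the spatial tensor product `F ⊗ C₀(Ω, ℂ)` with `C₀(Ω, F)`, under which
`x ⊗ g` is the function `ω ↦ g ω • x`. -/
noncomputable def C0.tensor (Ω : Type) [TopologicalSpace Ω] (F : ECAlg.{u} E) :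
    SpatialTensor F C₀(Ω, ℂ) where
  obj := C0 Ω F
  tmul := C0.tmulFun Ω F
  map_mul := C0.tmulFun_mul
  map_star := C0.tmulFun_star
  smul_tmul := fun α x g => ZeroAtInftyContinuousMap.ext fun ω => smul_comm α (g ω) x
  dense := C0.tmulFun_dense
  norm_sq := C0.tmulFun_norm_sq

/-- The C*-algebra `ℂ`, as an object of the category of C*-algebras, that is, of `ℂ`-C*-algebras. -/
noncomputable def complexAlgebra : ECAlg.{0} ℂ where
  carrier := ℂ

/-- The closed Euclidean unit ball of `ℝⁿ`. -/
def unitBall (n : ℕ) : Set (EuclideanSpace ℝ (Fin n)) := {x | ‖x‖ ≤ 1}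

theorem isCompact_unitBall (n : ℕ) : IsCompact (unitBall n) := by
  have h : unitBall n = Metric.closedBall 0 1 := by ext x; simp [unitBall]
  exact h ▸ isCompact_closedBall 0 1

namespace C0

variable {X : Type} [TopologicalSpace X] [T2Space X] {B Γ : Set X} {x₀ : X}

/-- The inclusion `C₀(B \ Γ, F) ⟶ C₀(B, F)`. -/
noncomputable def phi13 (hΓ : IsClosed Γ) (F : ECAlg.{u} E) : C0 ↥(B \ Γ) F ⟶ C0 ↥B F :=
  extend Set.sdiff_subset (by
    have h : ((↑) ⁻¹' (B \ Γ) : Set B) = (↑) ⁻¹' Γᶜ := by ext x; simp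
    exact h ▸ hΓ.isOpen_compl.preimage continuous_subtype_val) F

/-- The restriction `C₀(B, F) ⟶ C₀(Γ, F)`. -/
noncomputable def psi13 (hΓ : IsClosed Γ) (hΓB : Γ ⊆ B) (F : ECAlg.{u} E) : C0 ↥B F ⟶ C0 ↥Γ F :=
  restrict hΓB (hΓ.preimage continuous_subtype_val) F

/-- The inclusion `C₀(B \ Γ, F) ⟶ C₀(B \ {x₀}, F)`, for `x₀ ∈ Γ`. -/
noncomputable def phi23 (hΓ : IsClosed Γ) (hx : x₀ ∈ Γ) (F : ECAlg.{u} E) :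
    C0 ↥(B \ Γ) F ⟶ C0 ↥(B \ {x₀}) F :=
  extend (Set.sdiff_subset_sdiff_right (Set.singleton_subset_iff.2 hx)) (by
    have h : ((↑) ⁻¹' (B \ Γ) : Set ↥(B \ {x₀})) = (↑) ⁻¹' Γᶜ := by
      ext x; simpa using fun _ => x.2.1
    exact h ▸ hΓ.isOpen_compl.preimage continuous_subtype_val) F

/-- The restriction `C₀(B \ {x₀}, F) ⟶ C₀(Γ \ {x₀}, F)`. -/
noncomputable def psi23 (hΓ : IsClosed Γ) (hΓB : Γ ⊆ B) (F : ECAlg.{u} E) :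
    C0 ↥(B \ {x₀}) F ⟶ C0 ↥(Γ \ {x₀}) F :=
  restrict (Set.sdiff_subset_sdiff_left hΓB) (by
    have h : ((↑) ⁻¹' (Γ \ {x₀}) : Set ↥(B \ {x₀})) = (↑) ⁻¹' Γ := by
      ext x; simpa using fun _ => x.2.2
    exact h ▸ hΓ.preimage continuous_subtype_val) F

/-- The inclusion `C₀(Γ \ {x₀}, F) ⟶ C₀(Γ, F)`. -/
noncomputable def phiPoint (Γ : Set X) (x₀ : X) (F : ECAlg.{u} E) :
    C0 ↥(Γ \ {x₀}) F ⟶ C0 ↥Γ F :=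
  phi13 isClosed_singleton F

end C0

/-! Write B for the ball. The straight-line contraction of B to `ω₀` fixes `ω₀`, so precomposition
with it acts both on C(B, F) and on the ideal of functions vanishing at `ω₀`. Homotopy invariance
gives K_i(F) ≅ K_i(C(B, F)) through the constant functions, and K_i(C₀(B \ {ω₀}, F)) = 0. The
six-term sequence of 0 → C₀(B \ Γ, F) → C₀(B \ {ω₀}, F) → C₀(Γ', F) → 0 therefore collapses: its
index map δ₂₃ is an isomorphism. It is natural in F, so composing with it, or with its inverse,
carries a family Φ for one of the spaces to a family for the other with p and q exchanged.

The inclusions C₀(B \ {ω₀}, F) → C(B, F) and C₀(Γ', F) → C(Γ, F), with the identity of C₀(B \ Γ, F),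
form a morphism from this sequence to 0 → C₀(B \ Γ, F) → C(B, F) → C(Γ, F) → 0. Naturality of the
index maps reads δ₁₃ ∘ K_i(φ) = δ₂₃, so K_i(φ) ∘ δ₂₃⁻¹ is a right inverse of δ₁₃. Evaluation at a
point of Γ recovers a class of constants, so K_i(ψ₁₃) is injective, and the split sequence follows.

For finite Γ, removing one point at a time and using the splittings by functions supported at one
point identifies the groups with powers of K_i(F). Every class on Γ is the sum of a constant class a
and the image of a class d on Γ'. Its value is a at `ω₀` and a + d_ω at ω, which yields the
difference formula.

Two analytic facts carry the exactness claims: restriction of functions from a compact space to a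
closed subset is surjective for values in a C*-algebra, and C(Ω, -) is exact for compact Ω. Both
come from approximate solutions, glued by convexity and improved by iteration. Since the spatial
tensor product is only characterized, canonical isomorphisms reduce every realization to the model
C₀(Ω, F). -/

namespace ECAlg

/-! ### Morphisms and short exact sequences of E-C*-algebras -/

theorem hom_ext {F G : ECAlg.{u} E} {φ ψ : F ⟶ G} (h : ∀ x : F, φ x = ψ x) : φ = ψ :=
  Hom.ext (NonUnitalStarAlgHom.ext h)

@[simp]
theorem hom_comp_apply {F G H : ECAlg.{u} E} (φ : F ⟶ G) (ψ : G ⟶ H) (x : F) :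
    (φ ≫ ψ) x = ψ (φ x) := rfl

theorem continuous_hom {F G : ECAlg.{u} E} (φ : F ⟶ G) : Continuous φ :=
  AddMonoidHomClass.continuous_of_bound (Hom.toFun φ) 1 fun x => by
    simpa using NonUnitalStarAlgHom.norm_apply_le (Hom.toFun φ) x

/-- Injective C*-homomorphisms preserve the norm. This allows continuity to be tested after an
injective morphism. -/
theorem isometry_hom {F G : ECAlg.{u} E} (φ : F ⟶ G) (hφ : Function.Injective φ) : Isometry φ :=
  NonUnitalStarAlgHom.isometry (Hom.toFun φ) hφ

/-- The zero morphism. -/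
def zeroHom (F G : ECAlg.{u} E) : F ⟶ G where
  toFun := 0
  map_smul := fun α _ => (smul_zero α).symm

/-- A morphism whose values lie in the range of an injective morphism factors through it. -/
theorem exists_lift {F G H : ECAlg.{u} E} (φ : F ⟶ G) (hφ : Function.Injective φ) (θ : H ⟶ G)
    (hθ : ∀ x : H, ∃ y : F, φ y = θ x) : ∃ l : H ⟶ F, ∀ x : H, φ (l x) = θ x := by
  choose l hl using hθ
  exact ⟨{ toFun :=
            { toFun := l
              map_smul' := fun c x => hφ (by simp [hl])
              map_zero' := hφ (by simp [hl])
              map_add' := fun x y => hφ (by simp [hl])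
              map_mul' := fun x y => hφ (by simp [hl])
              map_star' := fun x => hφ (by simp [hl, map_star]) }
           map_smul := fun α x => hφ (by
            change φ (l (α • x)) = φ (α • l x)
            rw [hl, Hom.map_smul θ, Hom.map_smul φ, hl]) }, hl⟩

/-- Serves to move exactness from the models C(Ω, F) to arbitrary realizations of the tensor
products. -/
theorem ShortExact.of_iso {F G H F' G' H' : ECAlg.{u} E} {φ : F ⟶ G} {ψ : G ⟶ H} {φ' : F' ⟶ G'}
    {ψ' : G' ⟶ H'} (h : ShortExact φ ψ) (a : F ≅ F') (b : G ≅ G') (c : H ≅ H')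
    (h₁ : φ ≫ b.hom = a.hom ≫ φ') (h₂ : ψ ≫ c.hom = b.hom ≫ ψ') : ShortExact φ' ψ' := by
  have bij : ∀ {A B : ECAlg.{u} E} (e : A ≅ B), (∀ x : A, e.inv (e.hom x) = x) ∧
      ∀ y : B, e.hom (e.inv y) = y := fun e =>
    ⟨fun x => by rw [← hom_comp_apply, e.hom_inv_id]; rfl,
      fun y => by rw [← hom_comp_apply, e.inv_hom_id]; rfl⟩
  have e₁ : ∀ x, b.hom (φ x) = φ' (a.hom x) := fun x => by rw [← hom_comp_apply, h₁]; rfl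
  have e₂ : ∀ x, c.hom (ψ x) = ψ' (b.hom x) := fun x => by rw [← hom_comp_apply, h₂]; rfl
  refine ⟨fun x y hxy => ?_, fun y => ?_, fun z => ?_⟩
  · rw [← (bij a).2 x, ← (bij a).2 y, ← e₁, ← e₁] at hxy
    have := h.injective ((Function.LeftInverse.injective (bij b).1) hxy)
    rw [← (bij a).2 x, ← (bij a).2 y, this]
  · rw [← (bij b).2 y, ← e₂]
    constructor
    · intro h0
      obtain ⟨x, hx⟩ := (h.exact (b.inv y)).1 (Function.LeftInverse.injective (bij c).1
        (h0.trans (map_zero (Hom.toFun c.hom)).symm))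
      exact ⟨a.hom x, by rw [← e₁, hx]⟩
    · rintro ⟨x, hx⟩
      rw [← (bij a).2 x, ← e₁] at hx
      rw [(h.exact _).2 ⟨a.inv x, Function.LeftInverse.injective (bij b).1 hx⟩]
      exact map_zero (Hom.toFun c.hom)
  · obtain ⟨y, hy⟩ := h.surjective (c.inv z)
    exact ⟨b.hom y, by rw [← e₂, hy, (bij c).2]⟩

end ECAlg

/-! ### The algebras C₀(Ω, F) and their functoriality -/

namespace C0

section

variable {Ω : Type} [TopologicalSpace Ω] {F G H : ECAlg.{u} E}

@[ext]
theorem ext' {f g : C0 Ω F} (h : ∀ ω, f ω = g ω) : f = g :=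
  ZeroAtInftyContinuousMap.ext h

theorem continuous_coe (f : C0 Ω F) : Continuous f :=
  map_continuous (show C₀(Ω, F) from f)

theorem tendsto_zero (f : C0 Ω F) : Tendsto f (cocompact Ω) (𝓝 0) :=
  zero_at_infty (show C₀(Ω, F) from f)

theorem norm_coe_le (f : C0 Ω F) (ω : Ω) : ‖f ω‖ ≤ ‖f‖ :=
  (show C₀(Ω, F) from f).toBCF.norm_coe_le_norm ω

theorem norm_le {f : C0 Ω F} {r : ℝ} (hr : 0 ≤ r) : ‖f‖ ≤ r ↔ ∀ ω, ‖f ω‖ ≤ r :=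
  BoundedContinuousFunction.norm_le (f := (show C₀(Ω, F) from f).toBCF) hr

theorem sub_apply (f g : C0 Ω F) (ω : Ω) : (f - g) ω = f ω - g ω := rfl

theorem zero_apply (ω : Ω) : (0 : C0 Ω F) ω = 0 := rfl

/-- Elements of `C₀(Ω, F)`, from continuous functions vanishing at infinity. -/
def mk (f : Ω → F) (hf : Continuous f) (h0 : Tendsto f (cocompact Ω) (𝓝 0)) : C0 Ω F :=
  (⟨⟨f, hf⟩, h0⟩ : C₀(Ω, F))

/-- The morphism `C₀(Ω, F) ⟶ C₀(Ω, G)` given by composition with a morphism `F ⟶ G`. -/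
def map (Ω : Type) [TopologicalSpace Ω] (φ : F ⟶ G) : C0 Ω F ⟶ C0 Ω G where
  toFun :=
    { toFun := fun f => mk (fun ω => φ (f ω)) ((continuous_hom φ).comp (continuous_coe f)) (by
        have h := ((continuous_hom φ).tendsto 0).comp (tendsto_zero f)
        rwa [map_zero] at h)
      map_smul' := fun c f => ext' fun ω => map_smul (Hom.toFun φ) c (f ω)
      map_zero' := ext' fun ω => map_zero (Hom.toFun φ)
      map_add' := fun f g => ext' fun ω => map_add (Hom.toFun φ) (f ω) (g ω)
      map_mul' := fun f g => ext' fun ω => map_mul (Hom.toFun φ) (f ω) (g ω)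
      map_star' := fun f => ext' fun ω => map_star (Hom.toFun φ) (f ω) }
  map_smul := fun α f => ext' fun ω => Hom.map_smul φ α (f ω)

/-- Precomposition with a continuous map of compact spaces. -/
def precomp {Ω' : Type} [TopologicalSpace Ω'] [CompactSpace Ω] [CompactSpace Ω'] (g : C(Ω', Ω))
    (F : ECAlg.{u} E) : C0 Ω F ⟶ C0 Ω' F where
  toFun :=
    { toFun := fun f => mk (fun ω => f (g ω)) ((continuous_coe f).comp g.continuous) (by simp)
      map_smul' := fun _ _ => rfl
      map_zero' := rfl
      map_add' := fun _ _ => rfl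
      map_mul' := fun _ _ => rfl
      map_star' := fun _ => rfl }
  map_smul := fun _ _ => rfl

@[simp]
theorem precomp_apply {Ω' : Type} [TopologicalSpace Ω'] [CompactSpace Ω] [CompactSpace Ω']
    (g : C(Ω', Ω)) (f : C0 Ω F) (ω : Ω') : precomp g F f ω = f (g ω) := rfl

theorem subsingleton_of_isEmpty [IsEmpty Ω] : Subsingleton (C0 Ω F) :=
  ⟨fun _ _ => ext' fun ω => isEmptyElim ω⟩

/-- Joint continuity on P × Ω with Ω compact gives continuity in the parameter, uniformly over Ω.
This turns homotopies of spaces into homotopies of morphisms. -/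
theorem continuous_precomp {P : Type*} [TopologicalSpace P] [CompactSpace Ω] (h : P → C(Ω, Ω))
    (hh : Continuous fun x : P × Ω => h x.1 x.2) (f : C0 Ω F) :
    Continuous fun s => precomp (h s) F f := by
  let k : C(P × Ω, F) := ⟨fun x => f (h x.1 x.2), (continuous_coe f).comp hh⟩
  -- The curried map takes values in C(Ω, F), whose topology is that of the uniform distance because
  -- Ω is compact.
  have hk := k.curry.continuous
  rw [Metric.continuous_iff'] at hk ⊢
  intro s ε hε
  filter_upwards [hk s (ε / 2) (half_pos hε)] with t ht
  rw [dist_eq_norm]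
  refine lt_of_le_of_lt ((norm_le (half_pos hε).le).2 fun ω => ?_) (half_lt_self hε)
  rw [sub_apply, ← dist_eq_norm]
  exact ((ContinuousMap.dist_apply_le_dist ω).trans_lt ht).le

end

end C0

/-! ### Surjectivity by successive approximation, and exactness -/

/-- A continuous additive map into whose range every point can be approximated, with control of the
norm and with a relative error `1 / 2`, is surjective. -/
theorem surjective_of_forall_exists_norm_sub_le {A B : Type*} [NormedAddCommGroup A]
    [CompleteSpace A] [NormedAddCommGroup B] (T : A →+ B) (hT : Continuous T) (C : ℝ)
    (h : ∀ y, ∃ x, ‖x‖ ≤ C * ‖y‖ ∧ ‖y - T x‖ ≤ 1 / 2 * ‖y‖) : Function.Surjective T := by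
  choose g hg hgr using h
  intro y
  -- The error left after one approximation. Its iterates decay like 2⁻ⁿ, so the corrections sum to
  -- a preimage.
  let r : B → B := fun y => y - T (g y)
  have hr : ∀ n, ‖r^[n] y‖ ≤ (1 / 2) ^ n * ‖y‖ := by
    intro n
    induction n with
    | zero => simp
    | succ n ih =>
      rw [Function.iterate_succ_apply', pow_succ']
      refine (hgr _).trans ?_
      rw [mul_assoc]
      gcongr
  have hsum : Summable fun n => g (r^[n] y) := by
    refine Summable.of_norm_bounded
      (g := fun n => |C| * ((1 / 2) ^ n * ‖y‖)) ?_ fun n => ?_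
    · exact ((summable_geometric_of_lt_one (by norm_num) (by norm_num)).mul_right _).mul_left _
    · refine (hg _).trans ((mul_le_mul_of_nonneg_right (le_abs_self C) (norm_nonneg _)).trans ?_)
      exact mul_le_mul_of_nonneg_left (hr n) (abs_nonneg C)
  have hpart : ∀ n, T (∑ k ∈ Finset.range n, g (r^[k] y)) = y - r^[n] y := by
    intro n
    induction n with
    | zero => simp
    | succ n ih =>
      rw [Finset.sum_range_succ, map_add, ih, Function.iterate_succ_apply']
      change _ = y - (r^[n] y - T (g (r^[n] y)))
      abel
  refine ⟨∑' n, g (r^[n] y), tendsto_nhds_unique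
    ((hT.tendsto _).comp hsum.hasSum.tendsto_sum_nat) ?_⟩
  have h0 : Tendsto (fun n => r^[n] y) atTop (𝓝 0) := by
    refine squeeze_zero_norm hr ?_
    simpa using (tendsto_pow_atTop_nhds_zero_of_lt_one (r := (1 / 2 : ℝ)) (by norm_num)
      (by norm_num)).mul_const ‖y‖
  simpa [Function.comp_def, hpart] using h0.const_sub y

namespace C0

section

variable {X : Type} [TopologicalSpace X] [T2Space X] {S T : Set X} {F G H : ECAlg.{u} E}

theorem extend_apply_of_mem (hST : S ⊆ T) (hS : IsOpen ((↑) ⁻¹' S : Set T)) (f : C0 S F) {t : T}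
    (ht : (t : X) ∈ S) : extend hST hS F f t = f ⟨t, ht⟩ :=
  dif_pos ht

theorem extend_apply_of_notMem (hST : S ⊆ T) (hS : IsOpen ((↑) ⁻¹' S : Set T)) (f : C0 S F) {t : T}
    (ht : (t : X) ∉ S) : extend hST hS F f t = 0 :=
  dif_neg ht

theorem extend_injective (hST : S ⊆ T) (hS : IsOpen ((↑) ⁻¹' S : Set T)) :
    Function.Injective (extend hST hS F) := fun f g h => ext' fun s => by
  rw [← extend_apply_of_mem hST hS f (t := ⟨s, hST s.2⟩) s.2, h, extend_apply_of_mem hST hS g]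

/-- A function vanishing off S has its sets {‖f‖ ≥ ε} inside S. They are compact in T after
intersection with a suitable compact set, hence compact in S, so the restriction to S vanishes at
infinity. -/
theorem exists_extend_eq (hST : S ⊆ T) (hS : IsOpen ((↑) ⁻¹' S : Set T)) (f : C0 T F)
    (hf : ∀ t : T, (t : X) ∉ S → f t = 0) : ∃ g : C0 S F, extend hST hS F g = f := by
  refine ⟨mk (fun s => f (Set.inclusion hST s))
    ((continuous_coe f).comp (continuous_inclusion hST)) ?_, ext' fun t => ?_⟩
  · rw [Metric.tendsto_nhds]
    intro ε hε
    obtain ⟨C, hC, hCf⟩ := Filter.mem_cocompact.1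
      ((tendsto_zero f).eventually (Metric.ball_mem_nhds (0 : F) hε))
    have hK : IsCompact (C ∩ {t | ε ≤ ‖f t‖}) :=
      hC.inter_right (isClosed_le continuous_const (continuous_coe f).norm)
    have hi := (Topology.IsEmbedding.inclusion hST).isInducing
    refine Filter.mem_cocompact.2 ⟨_, hi.isCompact_preimage' hK ?_, fun s hs => ?_⟩
    · rintro t ⟨-, ht⟩
      have h1 : (t : X) ∈ S := by
        by_contra h
        rw [Set.mem_ofPred_eq, hf t h, norm_zero] at ht
        exact absurd ht (not_le.2 hε)
      exact ⟨⟨t, h1⟩, rfl⟩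
    · rw [Set.mem_ofPred_eq, dist_zero_right]
      by_contra h
      refine hs ⟨?_, not_lt.1 h⟩
      by_contra hc
      have h2 : dist _ (0 : F) < ε := hCf hc
      rw [dist_zero_right] at h2
      exact h h2
  · by_cases ht : (t : X) ∈ S
    · rw [extend_apply_of_mem hST hS _ ht]; rfl
    · rw [extend_apply_of_notMem hST hS _ ht, hf t ht]

/-- A vector-valued Tietze theorem. An extension with error at most ‖f‖ / 2 on S and norm at most
‖f‖ is a selection from convex sets, which exists globally as soon as constants work locally.
Iteration removes the error. -/
theorem restrict_surjective [CompactSpace T] (hST : S ⊆ T) (hS : IsClosed ((↑) ⁻¹' S : Set T)) :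
    Function.Surjective (restrict hST hS F) := by
  refine surjective_of_forall_exists_norm_sub_le
    (NonUnitalStarAlgHomClass.toNonUnitalStarAlgHom (Hom.toFun (restrict hST hS F)) :
      C0 T F →+ C0 S F) (continuous_hom _) 1 fun f => ?_
  rcases eq_or_ne f 0 with rfl | hf
  · exact ⟨0, by simp⟩
  have hf0 : 0 < ‖f‖ := norm_pos_iff.2 hf
  have key : ∃ g : C(T, F), ∀ t : T, g t ∈
      {v | ‖v‖ ≤ ‖f‖ ∧ ∀ h : (t : X) ∈ S, ‖v - f ⟨t, h⟩‖ ≤ 1 / 2 * ‖f‖} := by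
    refine exists_continuous_forall_mem_convex_of_local_const ?_ ?_
    · intro t
      have h1 : {v : F | ‖v‖ ≤ ‖f‖ ∧ ∀ h : (t : X) ∈ S, ‖v - f ⟨t, h⟩‖ ≤ 1 / 2 * ‖f‖} =
          Metric.closedBall 0 ‖f‖ ∩ ⋂ h : (t : X) ∈ S,
            Metric.closedBall (f ⟨t, h⟩) (1 / 2 * ‖f‖) := by
        ext v; simp [dist_eq_norm]
      rw [h1]
      exact (convex_closedBall _ _).inter (convex_iInter fun h => convex_closedBall _ _)
    · intro t
      -- Near a point of S the constant value of `f` there is admissible, by continuity. Away from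
      -- the closed set S only the norm bound is left, and 0 satisfies it.
      by_cases ht : (t : X) ∈ S
      · refine ⟨f ⟨t, ht⟩, ?_⟩
        have h1 := (continuous_coe f).tendsto ⟨t, ht⟩
        rw [Metric.tendsto_nhds] at h1
        have h2 := h1 (1 / 2 * ‖f‖) (by positivity)
        have h3 : 𝓝 (⟨t, ht⟩ : S) = comap (Set.inclusion hST) (𝓝 t) :=
          (Topology.IsEmbedding.inclusion hST).isInducing.nhds_eq_comap _
        rw [h3, eventually_comap] at h2
        filter_upwards [h2] with y hy
        refine ⟨norm_coe_le f _, fun h => ?_⟩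
        rw [norm_sub_rev, ← dist_eq_norm]
        exact (hy ⟨y, h⟩ rfl).le
      · refine ⟨0, ?_⟩
        filter_upwards [hS.isOpen_compl.mem_nhds ht] with y hy
        exact ⟨by simp, fun h => absurd h hy⟩
  obtain ⟨g, hg⟩ := key
  · refine ⟨mk g g.continuous (by simp), ?_, ?_⟩
    · rw [one_mul]
      exact (norm_le hf0.le).2 fun t => (hg t).1
    · refine (norm_le (by positivity)).2 fun s => ?_
      rw [sub_apply, norm_sub_rev]
      exact (hg ⟨s, hST s.2⟩).2 s.2

end

section

variable {Ω : Type} [TopologicalSpace Ω] {F G H : ECAlg.{u} E}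

/-- The open mapping theorem bounds preimages under `φ` by a constant C. A preimage of one value is
an approximate preimage of the nearby values, and the convex selection followed by iteration applies
again. -/
theorem map_surjective [CompactSpace Ω] [T2Space Ω] (φ : F ⟶ G) (hφ : Function.Surjective φ) :
    Function.Surjective (map Ω φ) := by
  let l : F →ₗ[ℂ] G := (Hom.toFun φ : F →ₙₐ[ℂ] G)
  obtain ⟨C, hC, hpre⟩ := ContinuousLinearMap.exists_preimage_norm_le
    (⟨l, continuous_hom φ⟩ : F →L[ℂ] G) hφ
  refine surjective_of_forall_exists_norm_sub_le
    (NonUnitalStarAlgHomClass.toNonUnitalStarAlgHom (Hom.toFun (map Ω φ)) :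
      C0 Ω F →+ C0 Ω G) (continuous_hom _) C fun f => ?_
  rcases eq_or_ne f 0 with rfl | hf
  · exact ⟨0, by simp⟩
  have hf0 : 0 < ‖f‖ := norm_pos_iff.2 hf
  have key : ∃ g : C(Ω, F), ∀ t, g t ∈ Metric.closedBall 0 (C * ‖f‖) ∩
      (l.restrictScalars ℝ) ⁻¹' Metric.closedBall (f t) (1 / 2 * ‖f‖) := by
    refine exists_continuous_forall_mem_convex_of_local_const
      (fun t => (convex_closedBall _ _).inter ((convex_closedBall _ _).linear_preimage _)) ?_
    · intro t
      obtain ⟨x, hx, hxn⟩ := hpre (f t)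
      refine ⟨x, ?_⟩
      have h1 := (continuous_coe f).tendsto t
      rw [Metric.tendsto_nhds] at h1
      filter_upwards [h1 (1 / 2 * ‖f‖) (by positivity)] with y hy
      refine ⟨?_, ?_⟩
      · rw [mem_closedBall_zero_iff]
        exact hxn.trans (mul_le_mul_of_nonneg_left (norm_coe_le f t) hC.le)
      · change dist (φ x) (f y) ≤ _
        have hx' : φ x = f t := hx
        rw [hx', dist_comm]
        exact hy.le
  obtain ⟨g, hg⟩ := key
  · refine ⟨mk g g.continuous (by simp), ?_, ?_⟩
    · exact (norm_le (by positivity)).2 fun t => mem_closedBall_zero_iff.1 (hg t).1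
    · refine (norm_le (by positivity)).2 fun s => ?_
      rw [sub_apply, ← dist_eq_norm, dist_comm]
      exact (hg s).2

/-- `C(Ω, -)` is exact for compact `Ω`. -/
theorem map_shortExact [CompactSpace Ω] [T2Space Ω] {φ : F ⟶ G} {ψ : G ⟶ H}
    (h : ShortExact φ ψ) : ShortExact (map Ω φ) (map Ω ψ) := by
  refine ⟨fun f g hfg => ext' fun ω => h.injective ?_, fun f => ⟨fun hf => ?_, ?_⟩,
    map_surjective ψ h.surjective⟩
  · exact DFunLike.congr_fun (F := C₀(Ω, G)) hfg ω
  · have h1 : ∀ ω, ∃ x, φ x = f ω := fun ω =>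
      (h.exact _).1 (DFunLike.congr_fun (F := C₀(Ω, H)) hf ω)
    choose g hg using h1
    -- The pointwise preimages are unique, and they depend continuously on the point because `φ` is
    -- an isometry onto its range.
    have hc : Continuous g := (isometry_hom φ h.injective).isEmbedding.continuous_iff.2 (by
      have : φ ∘ g = f := funext hg
      rw [this]
      exact continuous_coe f)
    exact ⟨mk g hc (by simp), ext' hg⟩
  · rintro ⟨g, rfl⟩
    exact ext' fun ω => (h.exact _).2 ⟨g ω, rfl⟩

end

end C0

namespace ECAlg

theorem homotopic_of_subsingleton {F : ECAlg.{u} E} [Subsingleton F] (φ ψ : F ⟶ F) :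
    Homotopic φ ψ :=
  ⟨fun _ => φ, rfl, hom_ext fun _ => Subsingleton.elim _ _, fun _ => continuous_const⟩

end ECAlg

/-! ### The two exact sequences of the pair (B, Γ), and finite spaces -/

namespace C0

section

variable {X : Type} [TopologicalSpace X] [T2Space X] {B Γ : Set X} {x₀ : X} {F : ECAlg.{u} E}

theorem phi13_injective (hΓ : IsClosed Γ) : Function.Injective (phi13 (B := B) hΓ F) :=
  extend_injective _ _

theorem phi13_apply_of_notMem (hΓ : IsClosed Γ) (f : C0 ↥(B \ Γ) F) {t : B} (ht : (t : X) ∉ Γ) :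
    phi13 hΓ F f t = f ⟨t, t.2, ht⟩ :=
  extend_apply_of_mem _ _ f (t := t) ⟨t.2, ht⟩

theorem phi13_apply_of_mem (hΓ : IsClosed Γ) (f : C0 ↥(B \ Γ) F) {t : B} (ht : (t : X) ∈ Γ) :
    phi13 hΓ F f t = 0 :=
  extend_apply_of_notMem _ _ f (t := t) fun h => h.2 ht

theorem phi23_apply_of_notMem (hΓ : IsClosed Γ) (hx : x₀ ∈ Γ) (f : C0 ↥(B \ Γ) F)
    {t : ↥(B \ {x₀})} (ht : (t : X) ∉ Γ) : phi23 hΓ hx F f t = f ⟨t, t.2.1, ht⟩ :=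
  extend_apply_of_mem _ _ f (t := t) ⟨t.2.1, ht⟩

theorem phi23_apply_of_mem (hΓ : IsClosed Γ) (hx : x₀ ∈ Γ) (f : C0 ↥(B \ Γ) F)
    {t : ↥(B \ {x₀})} (ht : (t : X) ∈ Γ) : phi23 hΓ hx F f t = 0 :=
  extend_apply_of_notMem _ _ f (t := t) fun h => h.2 ht

theorem exists_phi13_eq (hΓ : IsClosed Γ) (f : C0 B F) (hf : ∀ t : B, (t : X) ∈ Γ → f t = 0) :
    ∃ g, phi13 hΓ F g = f :=
  exists_extend_eq _ _ f fun t ht => hf t (by by_contra h; exact ht ⟨t.2, h⟩)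

theorem shortExact13 [CompactSpace B] (hΓ : IsClosed Γ) (hΓB : Γ ⊆ B) (F : ECAlg.{u} E) :
    ShortExact (phi13 (B := B) hΓ F) (psi13 hΓ hΓB F) := by
  refine ⟨phi13_injective hΓ, fun f => ⟨fun hf => ?_, ?_⟩, restrict_surjective _ _⟩
  · exact exists_phi13_eq hΓ f fun t ht => DFunLike.congr_fun (F := C₀(Γ, F)) hf ⟨t, ht⟩
  · rintro ⟨g, rfl⟩
    exact ext' fun s => phi13_apply_of_mem hΓ g s.2

theorem shortExact23 [CompactSpace B] (hΓ : IsClosed Γ) (hΓB : Γ ⊆ B) (hx : x₀ ∈ Γ)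
    (F : ECAlg.{u} E) :
    ShortExact (phi23 (B := B) hΓ hx F) (psi23 (x₀ := x₀) hΓ hΓB F) := by
  refine ⟨extend_injective _ _, fun f => ⟨fun hf => ?_, ?_⟩, fun f => ?_⟩
  · refine exists_extend_eq _ _ f fun t ht => ?_
    have h : (t : X) ∈ Γ := by by_contra h; exact ht ⟨t.2.1, h⟩
    exact DFunLike.congr_fun (F := C₀(↥(Γ \ {x₀}), F)) hf ⟨t, h, t.2.2⟩
  · rintro ⟨g, rfl⟩
    exact ext' fun s => phi23_apply_of_mem (B := B) hΓ hx g (t := ⟨s, hΓB s.2.1, s.2.2⟩) s.2.1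
  · obtain ⟨g, hg⟩ := (shortExact13 hΓ hΓB F).surjective (phiPoint Γ x₀ F f)
    have hg' : ∀ t : Γ, g ⟨t, hΓB t.2⟩ = phiPoint Γ x₀ F f t :=
      fun t => DFunLike.congr_fun (F := C₀(Γ, F)) hg t
    obtain ⟨k, rfl⟩ := exists_phi13_eq (isClosed_singleton (x := x₀)) g (by
      rintro ⟨t, ht⟩ rfl
      exact (hg' ⟨t, hx⟩).trans (phi13_apply_of_mem _ _ rfl))
    refine ⟨k, ext' fun s => ?_⟩
    have h1 := hg' ⟨s, s.2.1⟩
    have h2 := phi13_apply_of_notMem isClosed_singleton k (t := ⟨s, hΓB s.2.1⟩) s.2.2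
    exact h2.symm.trans <| h1.trans (phi13_apply_of_notMem isClosed_singleton f (t := ⟨s, s.2.1⟩) s.2.2)

/-- With `psi23_comp_phiPoint`, this gives the commuting squares of a morphism of exact sequences
that is the identity on C₀(B \ Γ, F). -/
theorem phi23_comp_phi13 (hΓ : IsClosed Γ) (hx : x₀ ∈ Γ) (F : ECAlg.{u} E) :
    phi23 (B := B) hΓ hx F ≫ phi13 isClosed_singleton F = phi13 hΓ F := by
  refine hom_ext fun f => ext' fun t => ?_
  by_cases h : (t : X) ∈ Γ
  · rw [hom_comp_apply, phi13_apply_of_mem hΓ f h]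
    by_cases h0 : (t : X) = x₀
    · exact phi13_apply_of_mem isClosed_singleton _ h0
    · rw [phi13_apply_of_notMem isClosed_singleton _ h0, phi23_apply_of_mem hΓ hx f h]
  · have h0 : (t : X) ∉ ({x₀} : Set X) := fun h0 => h (h0 ▸ hx)
    rw [hom_comp_apply, phi13_apply_of_notMem hΓ f h, phi13_apply_of_notMem isClosed_singleton _ h0,
      phi23_apply_of_notMem hΓ hx f h]

theorem psi23_comp_phiPoint (hΓ : IsClosed Γ) (hΓB : Γ ⊆ B) (F : ECAlg.{u} E) :
    psi23 (x₀ := x₀) hΓ hΓB F ≫ phiPoint Γ x₀ F = phi13 isClosed_singleton F ≫ psi13 hΓ hΓB F := by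
  refine hom_ext fun f => ext' fun t => ?_
  change phi13 isClosed_singleton F _ t = phi13 isClosed_singleton F f ⟨t, hΓB t.2⟩
  by_cases h0 : (t : X) ∈ ({x₀} : Set X)
  · exact (phi13_apply_of_mem _ _ h0).trans
      (phi13_apply_of_mem isClosed_singleton f (t := ⟨t, hΓB t.2⟩) h0).symm
  · exact (phi13_apply_of_notMem _ _ h0).trans
      (phi13_apply_of_notMem isClosed_singleton f (t := ⟨t, hΓB t.2⟩) h0).symm

/-- The square needed for the naturality in F of the index map δ₂₃; the square of the restrictions
commutes by definition. -/
theorem phi23_map {F G : ECAlg.{u} E} (hΓ : IsClosed Γ) (hx : x₀ ∈ Γ) (φ : F ⟶ G) :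
    phi23 (B := B) hΓ hx F ≫ map _ φ = map _ φ ≫ phi23 hΓ hx G := by
  refine hom_ext fun f => ext' fun t => ?_
  change φ (phi23 hΓ hx F f t) = phi23 hΓ hx G _ t
  by_cases h : (t : X) ∈ Γ
  · rw [phi23_apply_of_mem _ _ _ h, phi23_apply_of_mem _ _ _ h]
    exact map_zero (Hom.toFun φ)
  · rw [phi23_apply_of_notMem _ _ _ h, phi23_apply_of_notMem _ _ _ h]
    rfl

theorem phiPoint_comp_eval (ω : ↥(Γ \ {x₀})) (F : ECAlg.{u} E) :
    phiPoint Γ x₀ F ≫ eval (⟨ω, ω.2.1⟩ : Γ) F = eval ω F :=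
  hom_ext fun f => phi13_apply_of_notMem isClosed_singleton f (t := ⟨ω, ω.2.1⟩) ω.2.2

theorem phiPoint_comp_eval_self (hx : x₀ ∈ Γ) (F : ECAlg.{u} E) :
    phiPoint Γ x₀ F ≫ eval (⟨x₀, hx⟩ : Γ) F = zeroHom _ _ :=
  hom_ext fun f => phi13_apply_of_mem isClosed_singleton f (t := ⟨x₀, hx⟩) rfl

open Classical in
/-- The functions on a finite set that vanish outside of a given point. -/
noncomputable def single [Finite Γ] (ω : Γ) (F : ECAlg.{u} E) : F ⟶ C0 Γ F where
  toFun :=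
    { toFun := fun x => mk (fun t => if t = ω then x else 0) continuous_of_discreteTopology (by simp)
      map_smul' := fun c x => ext' fun t => by
        change (if t = ω then c • x else 0) = c • (if t = ω then x else 0)
        split_ifs <;> simp
      map_zero' := ext' fun t => by
        change (if t = ω then (0 : F) else 0) = 0
        split_ifs <;> rfl
      map_add' := fun x y => ext' fun t => by
        change (if t = ω then x + y else 0) = (if t = ω then x else 0) + (if t = ω then y else 0)
        split_ifs <;> simp
      map_mul' := fun x y => ext' fun t => by
        change (if t = ω then x * y else 0) = (if t = ω then x else 0) * (if t = ω then y else 0)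
        split_ifs <;> simp
      map_star' := fun x => ext' fun t => by
        change (if t = ω then star x else 0) = star (if t = ω then x else 0)
        split_ifs <;> simp }
  map_smul := fun α x => ext' fun t => by
    change (if t = ω then α • x else 0) = α • (if t = ω then x else 0)
    split_ifs <;> simp

theorem single_comp_eval [Finite Γ] (ω : Γ) (F : ECAlg.{u} E) : single ω F ≫ eval ω F = 𝟙 F :=
  hom_ext fun _ => if_pos rfl

theorem single_comp_eval_of_ne [Finite Γ] {ω ω' : Γ} (h : ω' ≠ ω) (F : ECAlg.{u} E) :
    single ω F ≫ eval ω' F = zeroHom _ _ :=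
  hom_ext fun _ => if_neg h

theorem shortExact_eval [Finite Γ] (ω : Γ) (F : ECAlg.{u} E) :
    ShortExact (phiPoint Γ (ω : X) F) (eval ω F) := by
  refine ⟨phi13_injective _, fun f => ⟨fun hf => ?_, ?_⟩, fun x => ⟨single ω F x, ?_⟩⟩
  · refine exists_phi13_eq isClosed_singleton f ?_
    rintro ⟨t, ht⟩ rfl
    exact hf
  · rintro ⟨g, rfl⟩
    exact phi13_apply_of_mem isClosed_singleton g (t := ω) rfl
  · rw [← hom_comp_apply, single_comp_eval]; rfl

end

/-! ### Contraction of a convex set to a point -/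

section

variable {V : Type} [NormedAddCommGroup V] [NormedSpace ℝ V] {B : Set V} {x₀ : V}

/-- The contraction of a convex set to one of its points. -/
noncomputable def contraction (hB : Convex ℝ B) (hx : x₀ ∈ B) (s : unitInterval) : C(B, B) where
  toFun ω := ⟨AffineMap.lineMap x₀ (ω : V) (s : ℝ), hB.lineMap_mem hx ω.2 s.2⟩
  continuous_toFun := by
    refine Continuous.subtype_mk ?_ _
    simp only [AffineMap.lineMap_apply_module]
    fun_prop

theorem continuous_contraction (hB : Convex ℝ B) (hx : x₀ ∈ B) :
    Continuous fun p : unitInterval × B => contraction hB hx p.1 p.2 := by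
  refine Continuous.subtype_mk ?_ _
  simp only [AffineMap.lineMap_apply_module]
  fun_prop

theorem contraction_zero (hB : Convex ℝ B) (hx : x₀ ∈ B) (ω : B) :
    contraction hB hx 0 ω = ⟨x₀, hx⟩ := Subtype.ext (AffineMap.lineMap_apply_zero _ _)

theorem contraction_one (hB : Convex ℝ B) (hx : x₀ ∈ B) (ω : B) :
    contraction hB hx 1 ω = ω := Subtype.ext (AffineMap.lineMap_apply_one _ _)

theorem contraction_self (hB : Convex ℝ B) (hx : x₀ ∈ B) (s : unitInterval) :
    contraction hB hx s ⟨x₀, hx⟩ = ⟨x₀, hx⟩ :=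
  Subtype.ext (AffineMap.lineMap_same_apply _ _)

theorem homotopic_eval_const [CompactSpace B] (hB : Convex ℝ B) (hx : x₀ ∈ B) (hc : IsCompact B)
    (F : ECAlg.{u} E) : Homotopic (eval (⟨x₀, hx⟩ : B) F ≫ const hc F) (𝟙 (C0 B F)) := by
  refine ⟨fun s => precomp (contraction hB hx s) F, hom_ext fun f => ext' fun ω => ?_,
    hom_ext fun f => ext' fun ω => ?_, fun f =>
      continuous_precomp _ (continuous_contraction hB hx) f⟩
  · rw [precomp_apply, contraction_zero]; rfl
  · rw [precomp_apply, contraction_one]; rfl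

/-- The contraction does not map B \ {x₀} to itself, since at time 0 everything goes to `x₀`. It is
therefore applied on C(B, F), where it preserves the functions vanishing at `x₀`, and the result is
lifted back to this ideal. -/
theorem homotopic_zeroHom_id [CompactSpace B] (hB : Convex ℝ B) (hx : x₀ ∈ B) (F : ECAlg.{u} E) :
    Homotopic (zeroHom _ _) (𝟙 (C0 ↥(B \ {x₀}) F)) := by
  have hi := phi13_injective (B := B) (F := F) (isClosed_singleton (x := x₀))
  have h := fun s : unitInterval => exists_lift (phi13 (B := B) isClosed_singleton F) hi
    (phi13 (B := B) (isClosed_singleton (x := x₀)) F ≫ precomp (contraction hB hx s) F) fun f =>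
      exists_phi13_eq _ _ fun t ht => by
        rw [hom_comp_apply, precomp_apply]
        obtain ⟨t, ht'⟩ := t
        obtain rfl : t = x₀ := ht
        rw [contraction_self]
        exact phi13_apply_of_mem _ f rfl
  choose l hl using h
  refine ⟨l, hom_ext fun f => hi ?_, hom_ext fun f => hi ?_, fun f => ?_⟩
  · rw [hl]
    refine ext' fun t => ?_
    rw [hom_comp_apply, precomp_apply, contraction_zero]
    exact (phi13_apply_of_mem _ f (t := ⟨x₀, hx⟩) rfl).trans <| (zero_apply t).symm.trans
      (congrArg (fun g : C0 B F => g t) (map_zero (Hom.toFun (phi13 _ F))).symm)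
  · rw [hl]
    refine ext' fun t => ?_
    rw [hom_comp_apply, precomp_apply, contraction_one]
    rfl
  · rw [(isometry_hom _ hi).isEmbedding.continuous_iff]
    have : ((phi13 (B := B) (isClosed_singleton (x := x₀)) F : _ → _) ∘ fun s => l s f) =
        fun s => precomp (contraction hB hx s) F (phi13 isClosed_singleton F f) :=
      funext fun s => hl s f
    rw [this]
    exact continuous_precomp _ (continuous_contraction hB hx) _

theorem nullHomotopic_sdiff_singleton [CompactSpace B] (hB : Convex ℝ B) (hx : x₀ ∈ B)
    (F : ECAlg.{u} E) : NullHomotopic (C0 ↥(B \ {x₀}) F) := by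
  have hZ : Subsingleton (C0 Empty F) := subsingleton_of_isEmpty
  refine ⟨C0 Empty F, hZ, zeroHom _ _, zeroHom _ _, ?_, homotopic_of_subsingleton _ _⟩
  exact homotopic_zeroHom_id hB hx F

end

end C0

/-! ### Uniqueness of the spatial tensor product -/

namespace SpatialTensor

variable {G : Type} [NonUnitalCStarAlgebra G] {F F' H : ECAlg.{u} E}

/-- Both squared norms are the supremum of the same set, which depends on the algebraic tensor
alone. -/
theorem norm_tmul_eq (T T' : SpatialTensor F G) (z : F ⊗[ℂ] G) : ‖T.tmul z‖ = ‖T'.tmul z‖ :=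
  (sq_eq_sq₀ (norm_nonneg _) (norm_nonneg _)).1 ((T.norm_sq z).unique (T'.norm_sq z))

/-- Morphisms out of a spatial tensor product are determined by the elementary tensors. -/
theorem hom_ext (T : SpatialTensor F G) {φ ψ : T.obj ⟶ H}
    (h : ∀ x y, φ (T.tmul (x ⊗ₜ y)) = ψ (T.tmul (x ⊗ₜ y))) : φ = ψ := by
  refine ECAlg.hom_ext fun x => congrFun (T.dense.equalizer (continuous_hom φ) (continuous_hom ψ)
    (funext fun z => ?_)) x
  change φ (T.tmul z) = ψ (T.tmul z)
  induction z using TensorProduct.induction_on with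
  | zero => simp
  | add a b ha hb => rw [map_add, map_add, map_add, ha, hb]
  | tmul x y => exact h x y

/-- The identity of the algebraic tensor product is isometric for the two norms, so it extends to
the completions. The algebraic identities pass to the limit by density. -/
theorem exists_compare (T T' : SpatialTensor F G) :
    ∃ c : T.obj ⟶ T'.obj, ∀ z, c (T.tmul z) = T'.tmul z := by
  let l : T.obj →L[ℂ] T'.obj := T'.tmul.extendOfNorm T.tmul
  have hl : ∀ z, l (T.tmul z) = T'.tmul z := LinearMap.extendOfNorm_eq T.dense
    ⟨1, fun z => by rw [one_mul, norm_tmul_eq T T']⟩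
  have hlc := l.continuous
  -- E-linearity needs one algebraic tensor representing α • z in all realizations at once.
  have smul : ∀ (α : E) (z : F ⊗[ℂ] G),
      ∃ w, ∀ S : SpatialTensor F G, α • S.tmul z = S.tmul w := fun α z => by
    induction z using TensorProduct.induction_on with
    | zero => exact ⟨0, fun S => by simp⟩
    | add a b ha hb =>
      obtain ⟨a', ha⟩ := ha
      obtain ⟨b', hb⟩ := hb
      exact ⟨a' + b', fun S => by rw [map_add, smul_add, ha, hb, map_add]⟩
    | tmul x y => exact ⟨_, fun S => S.smul_tmul α x y⟩
  refine ⟨{ toFun :=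
            { toFun := l
              map_smul' := map_smul l
              map_zero' := map_zero l
              map_add' := map_add l
              map_mul' := fun x y => ?_
              map_star' := fun x => ?_ }
            map_smul := fun α x => ?_ }, hl⟩
  · refine T.dense.induction_on₂ (p := fun x y => l (x * y) = l x * l y)
      (isClosed_eq (by fun_prop) (by fun_prop)) (fun z w => ?_) x y
    rw [← T.map_mul, hl, hl, hl, T'.map_mul]
  · refine T.dense.induction_on (p := fun x => l (star x) = star (l x)) x
      (isClosed_eq (by fun_prop) (by fun_prop)) fun z => ?_
    rw [← T.map_star, hl, hl, T'.map_star]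
  · refine T.dense.induction_on (p := fun x => l (α • x) = α • l x) x
      (isClosed_eq (by fun_prop) (by fun_prop)) fun z => ?_
    obtain ⟨w, hw⟩ := smul α z
    rw [hw, hl, hl, hw]

/-- The canonical morphism between two realizations of the spatial tensor product. -/
noncomputable def compare (T T' : SpatialTensor F G) : T.obj ⟶ T'.obj :=
  (exists_compare T T').choose

theorem compare_tmul (T T' : SpatialTensor F G) (z : F ⊗[ℂ] G) :
    compare T T' (T.tmul z) = T'.tmul z :=
  (exists_compare T T').choose_spec z

theorem compare_comp (T T' T'' : SpatialTensor F G) :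
    compare T T' ≫ compare T' T'' = compare T T'' :=
  T.hom_ext fun x y => by rw [hom_comp_apply, compare_tmul, compare_tmul, compare_tmul]

theorem compare_self (T : SpatialTensor F G) : compare T T = 𝟙 _ :=
  T.hom_ext fun x y => by rw [compare_tmul]; rfl

/-- The canonical isomorphism between two realizations of the spatial tensor product. -/
noncomputable def compareIso (T T' : SpatialTensor F G) : T.obj ≅ T'.obj where
  hom := compare T T'
  inv := compare T' T
  hom_inv_id := by rw [compare_comp, compare_self]
  inv_hom_id := by rw [compare_comp, compare_self]

/-- Any two realizations of φ ⊗ id agree under the canonical isomorphisms. Naturality thus has to be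
checked only on the models C₀(Ω, F). -/
theorem IsMap.compare_comp_eq {S T : SpatialTensor F G} {S' T' : SpatialTensor F' G} {φ : F ⟶ F'}
    {η : S.obj ⟶ S'.obj} {θ : T.obj ⟶ T'.obj} (hη : S.IsMap S' φ η) (hθ : T.IsMap T' φ θ) :
    compare S T ≫ θ = η ≫ compare S' T' :=
  S.hom_ext fun x y => by
    rw [hom_comp_apply, hom_comp_apply, compare_tmul, hη x y, compare_tmul, hθ x y]

theorem inclOne_comp_compare (T T' : SpatialTensor F G) (e : G)
    (he : ∀ y : G, e * y = y ∧ y * e = y) :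
    T.inclOne e he ≫ compare T T' = T'.inclOne e he :=
  ECAlg.hom_ext fun x => compare_tmul T T' (x ⊗ₜ e)

theorem IsMap.inclOne_comp {T : SpatialTensor F G} {T' : SpatialTensor F' G} {φ : F ⟶ F'}
    {θ : T.obj ⟶ T'.obj} (hθ : T.IsMap T' φ θ) (e : G) (he : ∀ y : G, e * y = y ∧ y * e = y) :
    T.inclOne e he ≫ θ = φ ≫ T'.inclOne e he :=
  ECAlg.hom_ext fun x => hθ x e

end SpatialTensor

/-! ### C₀(Ω, F) as a tensor product -/

namespace C0

variable {Ω : Type} [TopologicalSpace Ω] {F F' F'' : ECAlg.{u} E}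

theorem isMap_map (φ : F ⟶ F') : (tensor Ω F).IsMap (tensor Ω F') φ (map Ω φ) := fun x g =>
  ext' fun ω => map_smul (Hom.toFun φ) (g ω) x

/-- Tensoring with `C(Ω, ℂ)` is exact for compact `Ω`. -/
theorem shortExact_of_isMap [CompactSpace Ω] [T2Space Ω] {φ : F ⟶ F'} {ψ : F' ⟶ F''}
    (h : ShortExact φ ψ) {T : SpatialTensor F C₀(Ω, ℂ)} {T' : SpatialTensor F' C₀(Ω, ℂ)}
    {T'' : SpatialTensor F'' C₀(Ω, ℂ)} {θ : T.obj ⟶ T'.obj} {η : T'.obj ⟶ T''.obj}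
    (hθ : T.IsMap T' φ θ) (hη : T'.IsMap T'' ψ η) : ShortExact θ η :=
  (map_shortExact h).of_iso ((tensor Ω F).compareIso T) ((tensor Ω F').compareIso T')
    ((tensor Ω F'').compareIso T'') ((isMap_map φ).compare_comp_eq hθ).symm
    ((isMap_map ψ).compare_comp_eq hη).symm

theorem exists_unit (B : Type) [TopologicalSpace B] [CompactSpace B] :
    ∃ e : C₀(B, ℂ), ∀ y, e * y = y ∧ y * e = y :=
  ⟨⟨⟨fun _ => 1, continuous_const⟩, by simp⟩, fun y =>
    ⟨ZeroAtInftyContinuousMap.ext fun ω => one_mul (y ω),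
      ZeroAtInftyContinuousMap.ext fun ω => mul_one (y ω)⟩⟩

theorem unit_apply {B : Type} [TopologicalSpace B] [CompactSpace B] {e : C₀(B, ℂ)}
    (he : ∀ y, e * y = y ∧ y * e = y) (ω : B) : e ω = 1 := by
  obtain ⟨e', he'⟩ := exists_unit B
  have h1 : ∀ y : C₀(B, ℂ), e ω * y ω = y ω := fun y => DFunLike.congr_fun (he y).1 ω
  exact (mul_one _).symm.trans (h1 ⟨⟨fun _ => 1, continuous_const⟩, by simp⟩)

theorem inclOne_tensor_eq_const {X : Type} [TopologicalSpace X] {B : Set X} [CompactSpace B]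
    (hB : IsCompact B) {e : C₀(B, ℂ)} (he : ∀ y, e * y = y ∧ y * e = y) (F : ECAlg.{u} E) :
    (tensor B F).inclOne e he = const hB F :=
  hom_ext fun x => ext' fun ω => by
    change e ω • x = x
    rw [unit_apply he, one_smul]

end C0

theorem zmod_two_eq_add_one {i j : ZMod 2} (h : j = i + 1) : i = j + 1 := by
  rw [h, add_assoc, show (1 + 1 : ZMod 2) = 0 from rfl, add_zero]

/-! ### Consequences of the axioms of K-theory -/

namespace KTheory

variable (𝒦 : KTheory.{u, v, w} E) {F G H F' G' H' : ECAlg.{u} E}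

theorem map_comp_apply (i : ZMod 2) (φ : F ⟶ G) (ψ : G ⟶ H) (x : 𝒦.K i F) :
    𝒦.map i (φ ≫ ψ) x = 𝒦.map i ψ (𝒦.map i φ x) := by
  simp [map]

theorem map_id_apply (i : ZMod 2) (x : 𝒦.K i F) : 𝒦.map i (𝟙 F) x = x := by
  simp [map]

/-- The zero morphism factors through the zero algebra, realized as the functions on the empty
space. -/
theorem map_zeroHom_apply (i : ZMod 2) (x : 𝒦.K i F) : 𝒦.map i (zeroHom F G) x = 0 := by
  have := 𝒦.null i (C0 Empty F) C0.subsingleton_of_isEmpty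
  have h : zeroHom F G = zeroHom F (C0 Empty F) ≫ zeroHom _ G := rfl
  rw [h, map_comp_apply, Subsingleton.elim (𝒦.map i (zeroHom F (C0 Empty F)) x) 0, map_zero]

theorem map_eq_of_comp_eq (i : ZMod 2) {φ : F ⟶ G} {ψ : G ⟶ H} {φ' : F ⟶ G'} {ψ' : G' ⟶ H}
    (h : φ ≫ ψ = φ' ≫ ψ') (x : 𝒦.K i F) :
    𝒦.map i ψ (𝒦.map i φ x) = 𝒦.map i ψ' (𝒦.map i φ' x) := by
  rw [← map_comp_apply, h, map_comp_apply]

/-- The isomorphism of `K`-groups given by an isomorphism of `E`-C*-algebras. -/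
def mapEquiv (i : ZMod 2) (e : F ≅ G) : 𝒦.K i F ≃+ 𝒦.K i G where
  toFun := 𝒦.map i e.hom
  invFun := 𝒦.map i e.inv
  left_inv x := by rw [← map_comp_apply, e.hom_inv_id, map_id_apply]
  right_inv x := by rw [← map_comp_apply, e.inv_hom_id, map_id_apply]
  map_add' := map_add _

theorem subsingleton_of_homotopic (h : Homotopic (zeroHom F F) (𝟙 F)) (i : ZMod 2) :
    Subsingleton (𝒦.K i F) := by
  refine subsingleton_of_forall_eq 0 fun x => ?_
  have h1 : 𝒦.map i (zeroHom F F) x = 𝒦.map i (𝟙 F) x := by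
    simp only [map, 𝒦.homotopy i _ _ h]
  rwa [map_zeroHom_apply, map_id_apply, eq_comm] at h1

theorem map_bijective_of_homotopic {φ : F ⟶ G} {ψ : G ⟶ F} (h : φ ≫ ψ = 𝟙 F)
    (h' : Homotopic (ψ ≫ φ) (𝟙 G)) (i : ZMod 2) : Function.Bijective (𝒦.map i φ) := by
  refine Function.bijective_iff_has_inverse.2 ⟨𝒦.map i ψ, fun x => ?_, fun x => ?_⟩
  · rw [← map_comp_apply, h, map_id_apply]
  · have h1 : 𝒦.map i (ψ ≫ φ) x = 𝒦.map i (𝟙 G) x := by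
      simp only [map, 𝒦.homotopy i _ _ h']
    rwa [map_comp_apply, map_id_apply] at h1

/-- The index map is an isomorphism if the `K`-groups of the middle algebra vanish. -/
theorem index_bijective {φ : F ⟶ G} {ψ : G ⟶ H} (h : ShortExact φ ψ)
    (hG : ∀ i, Subsingleton (𝒦.K i G)) {i j : ZMod 2} (hij : j = i + 1) :
    Function.Bijective (𝒦.index h hij) := by
  refine ⟨(injective_iff_map_eq_zero _).2 fun c hc => ?_, fun a => ?_⟩
  · obtain ⟨b, rfl⟩ := (𝒦.exact_right h hij c).1 hc
    have := hG i
    rw [Subsingleton.elim b 0]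
    exact map_zero (𝒦.map i ψ)
  · have := hG j
    exact (𝒦.exact_left h hij a).1 (Subsingleton.elim _ _)

section Finite

variable {X : Type} [TopologicalSpace X] [T2Space X]

/-- Induction on the number of points. Evaluation at a point x is split by the functions supported
at x, so a class killed by it comes from S \ {x}, and the other evaluations are unchanged there. -/
theorem eq_zero_of_forall_map_eval_eq_zero (i : ZMod 2) (F : ECAlg.{u} E) (n : ℕ) (S : Set X)
    (hS : S.Finite) (hn : S.ncard = n) (c : 𝒦.K i (C0 S F))
    (hc : ∀ ω : S, 𝒦.map i (C0.eval ω F) c = 0) : c = 0 := by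
  induction n generalizing S with
  | zero =>
    have : IsEmpty S := Set.isEmpty_coe_sort.2 ((Set.ncard_eq_zero hS).1 hn)
    have := 𝒦.null i (C0 S F) C0.subsingleton_of_isEmpty
    exact Subsingleton.elim _ _
  | succ n ih =>
    obtain ⟨x, hx⟩ : S.Nonempty := by
      rw [← Set.ncard_pos hS]; omega
    have := hS.to_subtype
    obtain ⟨-, h2, -⟩ := 𝒦.split_exact i _ _ (C0.single ⟨x, hx⟩ F)
      (C0.shortExact_eval ⟨x, hx⟩ F) (C0.single_comp_eval _ F)
    obtain ⟨d, rfl⟩ := (h2 c).1 (hc ⟨x, hx⟩)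
    rw [ih (S \ {x}) hS.sdiff (by rw [Set.ncard_sdiff_singleton_of_mem hx, hn]; rfl) d fun ω => ?_]
    · exact map_zero (𝒦.map i _)
    · rw [← C0.phiPoint_comp_eval ω F, map_comp_apply]
      exact hc _

theorem pi_map_eval_bijective (i : ZMod 2) (F : ECAlg.{u} E) {S : Set X} (hS : S.Finite) :
    Function.Bijective (AddMonoidHom.pi fun ω : S => 𝒦.map i (C0.eval ω F)) := by
  have := hS.to_subtype
  have := Fintype.ofFinite S
  refine ⟨(injective_iff_map_eq_zero _).2 fun c hc => ?_, fun a => ?_⟩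
  · exact 𝒦.eq_zero_of_forall_map_eval_eq_zero i F _ S hS rfl c fun ω => congrFun hc ω
  · refine ⟨∑ ω, 𝒦.map i (C0.single ω F) (a ω), funext fun ω' => ?_⟩
    rw [AddMonoidHom.pi_apply, map_sum, Finset.sum_eq_single ω']
    · rw [← map_comp_apply, C0.single_comp_eval, map_id_apply]
    · intro ω _ h
      rw [← map_comp_apply, C0.single_comp_eval_of_ne h.symm, map_zeroHom_apply]
    · simp

/-- The isomorphism `K_i(C₀(S, F)) ≅ K_i(F)^S` given by the evaluations at the points of a finite
set `S`. -/
noncomputable def evalEquiv (i : ZMod 2) (F : ECAlg.{u} E) {S : Set X} (hS : S.Finite) :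
    𝒦.K i (C0 S F) ≃+ (S → 𝒦.K i F) :=
  AddEquiv.ofBijective _ (𝒦.pi_map_eval_bijective i F hS)

theorem evalEquiv_apply (i : ZMod 2) (F : ECAlg.{u} E) {S : Set X} (hS : S.Finite)
    (c : 𝒦.K i (C0 S F)) (ω : S) : 𝒦.evalEquiv i F hS c ω = 𝒦.map i (C0.eval ω F) c := rfl

end Finite

/-! ### Families of isomorphisms for the class Υ -/

section Upsilon

variable {𝒦} {Ω Ω' : Type} [TopologicalSpace Ω] [TopologicalSpace Ω'] {p q : ℕ}

/-- A family of isomorphisms onto the groups `K_i(C₀(Ω, F))`, natural in `F`, extends to all the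
realizations of the tensor products `F ⊗ C₀(Ω, ℂ)`. -/
noncomputable def UpsilonFamily.ofC0
    (e : ∀ {i j : ZMod 2}, j = i + 1 → ∀ F : ECAlg.{u} E,
      ((Fin p → 𝒦.K i F) × (Fin q → 𝒦.K j F)) ≃+ 𝒦.K i (C0 Ω F))
    (he : ∀ {i j : ZMod 2} (hij : j = i + 1) {F F' : ECAlg.{u} E} (φ : F ⟶ F')
      (a : Fin p → 𝒦.K i F) (b : Fin q → 𝒦.K j F),
      𝒦.map i (C0.map Ω φ) (e hij F (a, b)) =
        e hij F' (fun k => 𝒦.map i φ (a k), fun k => 𝒦.map j φ (b k))) :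
    𝒦.UpsilonFamily C₀(Ω, ℂ) p q where
  iso {i j} hij {F} T := (e hij F).trans (𝒦.mapEquiv i ((C0.tensor Ω F).compareIso T))
  natural {i j} hij {F F'} T T' φ θ h a b := by
    change 𝒦.map i θ (𝒦.map i ((C0.tensor Ω F).compare T) (e hij F (a, b))) =
      𝒦.map i ((C0.tensor Ω F').compare T') (e hij F' _)
    rw [← he]
    exact 𝒦.map_eq_of_comp_eq i ((C0.isMap_map φ).compare_comp_eq h) _

theorem UpsilonFamily.ofC0_iso_tensor
    (e : ∀ {i j : ZMod 2}, j = i + 1 → ∀ F : ECAlg.{u} E,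
      ((Fin p → 𝒦.K i F) × (Fin q → 𝒦.K j F)) ≃+ 𝒦.K i (C0 Ω F))
    (he : ∀ {i j : ZMod 2} (hij : j = i + 1) {F F' : ECAlg.{u} E} (φ : F ⟶ F')
      (a : Fin p → 𝒦.K i F) (b : Fin q → 𝒦.K j F),
      𝒦.map i (C0.map Ω φ) (e hij F (a, b)) =
        e hij F' (fun k => 𝒦.map i φ (a k), fun k => 𝒦.map j φ (b k)))
    {i j : ZMod 2} (hij : j = i + 1) (F : ECAlg.{u} E)
    (x : (Fin p → 𝒦.K i F) × (Fin q → 𝒦.K j F)) :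
    (UpsilonFamily.ofC0 e he).iso hij (C0.tensor Ω F) x = e hij F x := by
  change 𝒦.map i ((C0.tensor Ω F).compare (C0.tensor Ω F)) (e hij F x) = _
  rw [SpatialTensor.compare_self]
  exact 𝒦.map_id_apply i _

/-- Natural isomorphisms `K_i(C₀(Ω, F)) ≅ K_{i+1}(C₀(Ω', F))` exchange the roles of `p` and `q`. -/
theorem UpsilonFamily.exists_transfer
    (δ : ∀ {i j : ZMod 2}, j = i + 1 → ∀ F : ECAlg.{u} E, 𝒦.K i (C0 Ω F) ≃+ 𝒦.K j (C0 Ω' F))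
    (hδ : ∀ {i j : ZMod 2} (hij : j = i + 1) {F F' : ECAlg.{u} E} (φ : F ⟶ F')
      (c : 𝒦.K i (C0 Ω F)),
      𝒦.map j (C0.map Ω' φ) (δ hij F c) = δ hij F' (𝒦.map i (C0.map Ω φ) c))
    (Φ : 𝒦.UpsilonFamily C₀(Ω, ℂ) p q) :
    ∃ Ψ : 𝒦.UpsilonFamily C₀(Ω', ℂ) q p, ∀ {i j : ZMod 2} (hij : j = i + 1) (hji : i = j + 1)
      (F : ECAlg.{u} E) (a : Fin p → 𝒦.K j F) (b : Fin q → 𝒦.K i F),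
      Ψ.iso hij (C0.tensor Ω' F) (b, a) = δ hji F (Φ.iso hji (C0.tensor Ω F) (a, b)) := by
  -- In degree i the new isomorphism uses Φ in degree j = i + 1 and then `δ` from degree j to j + 1
  -- = i. In degree j the factor K_j(F) is the one with exponent p, which is why the factors are
  -- swapped.
  refine ⟨UpsilonFamily.ofC0 (fun {i j} hij F => AddEquiv.prodComm.trans
    ((Φ.iso (zmod_two_eq_add_one hij) (C0.tensor Ω F)).trans
      (δ (zmod_two_eq_add_one hij) F))) ?_, fun hij hji F a b => ?_⟩
  · intro i j hij F F' φ b a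
    change 𝒦.map i (C0.map Ω' φ) (δ _ F (Φ.iso _ (C0.tensor Ω F) (a, b))) =
      δ _ F' (Φ.iso _ (C0.tensor Ω F') (_, _))
    refine (hδ _ φ _).trans (congrArg _ ?_)
    exact Φ.natural _ (C0.tensor Ω F) (C0.tensor Ω F') φ _ (C0.isMap_map φ) a b
  · rw [UpsilonFamily.ofC0_iso_tensor]
    rfl

/-- A trivial family, for a space with vanishing `K`-groups. -/
theorem upsilonNull_of_subsingleton (h : ∀ i F, Subsingleton (𝒦.K i (C0 Ω F))) :
    𝒦.UpsilonNull C₀(Ω, ℂ) :=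
  ⟨UpsilonFamily.ofC0 (fun {i _} _ F => have := h i F; AddEquiv.ofBijective
    (0 : _ →+ _) ⟨fun _ _ _ => Subsingleton.elim _ _, fun _ => ⟨0, Subsingleton.elim _ _⟩⟩)
    fun {i _} _ _ F' _ _ _ => have := h i F'; Subsingleton.elim _ _⟩

variable (𝒦) in
theorem inUpsilonOne_of_bijective {X : Type} [TopologicalSpace X] {B : Set X} [CompactSpace B]
    (hB : IsCompact B)
    (h : ∀ (i : ZMod 2) (F : ECAlg.{u} E), Function.Bijective (𝒦.map i (C0.const hB F))) :
    𝒦.InUpsilonOne C₀(B, ℂ) := by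
  obtain ⟨e, he⟩ := C0.exists_unit B
  have hbij : ∀ (i : ZMod 2) {F : ECAlg.{u} E} (T : SpatialTensor F C₀(B, ℂ)),
      Function.Bijective (𝒦.map i (T.inclOne e he)) := fun i F T => by
    have h1 : ⇑(𝒦.map i (T.inclOne e he)) =
        𝒦.mapEquiv i ((C0.tensor B F).compareIso T) ∘ 𝒦.map i (C0.const hB F) := funext fun x => by
      rw [← SpatialTensor.inclOne_comp_compare (C0.tensor B F), map_comp_apply,
        C0.inclOne_tensor_eq_const hB]
      rfl
    rw [h1]
    exact (AddEquiv.bijective _).comp (h i F)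
  let l : ∀ {i j : ZMod 2} (F : ECAlg.{u} E),
      ((Fin 1 → 𝒦.K i F) × (Fin 0 → 𝒦.K j F)) ≃+ 𝒦.K i F := fun {i j} F =>
    { toFun := fun x => x.1 0
      invFun := fun a => (fun _ => a, 0)
      left_inv := fun x => Prod.ext (funext fun k => by rw [Subsingleton.elim k 0])
        (Subsingleton.elim _ _)
      right_inv := fun _ => rfl
      map_add' := fun _ _ => rfl }
  refine ⟨e, he, ⟨fun {i j} _ {F} T => (l F).trans (AddEquiv.ofBijective _ (hbij i T)),
    fun {i j} _ {F F'} T T' φ θ hθ a b => ?_⟩, fun {i j} _ {F} T a b => rfl⟩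
  exact 𝒦.map_eq_of_comp_eq i (hθ.inclOne_comp e he) (a 0)

/-- The maps x ↦ x ⊗ 1 form a morphism from the given sequence to its tensor product. Compatibility
with the index maps is exactly their naturality for this morphism. -/
theorem UpsilonFamily.IsInclOne.compatible [CompactSpace Ω] [T2Space Ω] {e : C₀(Ω, ℂ)}
    {he : ∀ y, e * y = y ∧ y * e = y} {Φ : 𝒦.UpsilonFamily C₀(Ω, ℂ) 1 0} (hΦ : Φ.IsInclOne e he)
    {φ : F ⟶ G} {ψ : G ⟶ H} (h : ShortExact φ ψ) : Φ.Compatible h := by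
  intro T₁ T₂ T₃ θ₁ θ₂ h₁ h₂
  have hT := C0.shortExact_of_isMap h h₁ h₂
  refine ⟨hT, fun {i j} hij hji a b => ?_⟩
  rw [hΦ, hΦ]
  exact (𝒦.index_natural h hT (T₁.inclOne e he) (T₂.inclOne e he) (T₃.inclOne e he)
    (h₁.inclOne_comp e he).symm (h₂.inclOne_comp e he).symm hij (a 0)).symm

end Upsilon

end KTheory

namespace KTheory

theorem exists_upsilonFamily_of_finite (𝒦 : KTheory.{u, v, w} E) {X : Type}
    [TopologicalSpace X] [T2Space X] {S : Set X} (hS : S.Finite) {m : ℕ} (e : Fin m ≃ S) :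
    ∃ Φ : 𝒦.UpsilonFamily C₀(S, ℂ) m 0, ∀ {i j : ZMod 2} (hij : j = i + 1) (F : ECAlg.{u} E)
      (a : Fin m → 𝒦.K i F) (b : Fin 0 → 𝒦.K j F) (k : Fin m),
      𝒦.map i (C0.eval (e k) F) (Φ.iso hij (C0.tensor S F) (a, b)) = a k := by
  let l : ∀ {i j : ZMod 2} (_ : j = i + 1) (F : ECAlg.{u} E),
      ((Fin m → 𝒦.K i F) × (Fin 0 → 𝒦.K j F)) ≃+ 𝒦.K i (C0 S F) := fun {i j} _ F =>
    AddEquiv.trans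
      { toFun := fun x s => x.1 (e.symm s)
        invFun := fun a => (fun k => a (e k), 0)
        left_inv := fun x => Prod.ext (funext fun k => by simp) (Subsingleton.elim _ _)
        right_inv := fun a => funext fun s => by simp
        map_add' := fun _ _ => rfl } (𝒦.evalEquiv i F hS).symm
  have hl : ∀ {i j : ZMod 2} (hij : j = i + 1) (F : ECAlg.{u} E)
      (x : (Fin m → 𝒦.K i F) × (Fin 0 → 𝒦.K j F)) (s : S),
      𝒦.map i (C0.eval s F) (l hij F x) = x.1 (e.symm s) := fun {i j} hij F x s =>
    congrFun ((𝒦.evalEquiv i F hS).apply_symm_apply _) s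
  refine ⟨UpsilonFamily.ofC0 l fun {i j} hij F F' φ a b => ?_, fun {i j} hij F a b k => ?_⟩
  · refine (𝒦.evalEquiv i F' hS).injective (funext fun s => ?_)
    rw [evalEquiv_apply, evalEquiv_apply, hl hij, 𝒦.map_eq_of_comp_eq i
      (show C0.map S φ ≫ C0.eval s F' = C0.eval s F ≫ φ from rfl), hl hij]
  · rw [UpsilonFamily.ofC0_iso_tensor]
    exact (hl hij F (a, b) (e k)).trans (by simp)

end KTheory

/-! ### The closed unit ball and the theorem -/

theorem convex_unitBall (n : ℕ) : Convex ℝ (unitBall n) := by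
  have h : unitBall n = Metric.closedBall 0 1 := by ext x; simp [unitBall]
  exact h ▸ convex_closedBall 0 1

theorem theorem17p1 {E : Type v} [CommCStarAlgebra E] (𝒦 : KTheory.{u, v, w} E) (n : ℕ)
    (Γ : Set (EuclideanSpace ℝ (Fin n))) (hΓ : IsClosed Γ) (hΓB : Γ ⊆ unitBall n)
    (ω₀ : EuclideanSpace ℝ (Fin n)) (hω₀ : ω₀ ∈ Γ) :
    -- the ball without the point `ω₀`, and the ball
    (NullHomotopic (C0 ↥(unitBall n \ {ω₀}) complexAlgebra) ∧
      𝒦.UpsilonNull C₀(↥(unitBall n \ {ω₀}), ℂ) ∧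
      𝒦.InUpsilonOne C₀(↥(unitBall n), ℂ) ∧
      ∀ (e : C₀(↥(unitBall n), ℂ)) (he : ∀ y, e * y = y ∧ y * e = y)
        (Φ : 𝒦.UpsilonFamily C₀(↥(unitBall n), ℂ) 1 0), Φ.IsInclOne e he →
        ∀ {F₁ F₂ F₃ : ECAlg.{u} E} {φ₁ : F₁ ⟶ F₂} {φ₂ : F₂ ⟶ F₃} (h : ShortExact φ₁ φ₂),
          Φ.Compatible h) ∧
    -- the two short exact sequences, with index maps `δ₁₃`, `δ₂₃`, and `δ₂₃` is an isomorphism `δ`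
    ∃ (h13 : ∀ F : ECAlg.{u} E, ShortExact (C0.phi13 (B := unitBall n) hΓ F) (C0.psi13 hΓ hΓB F))
      (h23 : ∀ F : ECAlg.{u} E,
        ShortExact (C0.phi23 (B := unitBall n) hΓ hω₀ F) (C0.psi23 hΓ hΓB F))
      (δ : ∀ {i j : ZMod 2}, j = i + 1 → ∀ F : ECAlg.{u} E,
        𝒦.K i (C0 ↥(Γ \ {ω₀}) F) ≃+ 𝒦.K j (C0 ↥(unitBall n \ Γ) F)),
      (∀ {i j : ZMod 2} (hij : j = i + 1) (F : ECAlg.{u} E) (c : 𝒦.K i (C0 ↥(Γ \ {ω₀}) F)),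
        δ hij F c = 𝒦.index (h23 F) hij c) ∧
      (∀ {i j : ZMod 2}, j = i + 1 → ∀ F : ECAlg.{u} E,
        Nonempty (𝒦.K i (C0 ↥(unitBall n \ Γ) F) ≃+ 𝒦.K j (C0 ↥(Γ \ {ω₀}) F))) ∧
      -- the split exact sequence
      (∀ {i j : ZMod 2} (hij : j = i + 1) (F : ECAlg.{u} E),
        Function.Injective (𝒦.map i (C0.psi13 hΓ hΓB F)) ∧
        (∀ c : 𝒦.K i (C0 ↥Γ F),
          𝒦.index (h13 F) hij c = 0 ↔ ∃ a, 𝒦.map i (C0.psi13 hΓ hΓB F) a = c) ∧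
        Function.Surjective (𝒦.index (h13 F) hij) ∧
        (∀ b : 𝒦.K j (C0 ↥(unitBall n \ Γ) F),
          𝒦.index (h13 F) hij (𝒦.map i (C0.phiPoint Γ ω₀ F) ((δ hij F).symm b)) = b) ∧
        ∃ s : (𝒦.K i (C0 ↥(unitBall n) F) × 𝒦.K j (C0 ↥(unitBall n \ Γ) F)) ≃+ 𝒦.K i (C0 ↥Γ F),
          ∀ a b, s (a, b) = 𝒦.map i (C0.psi13 hΓ hΓB F) a +
            𝒦.map i (C0.phiPoint Γ ω₀ F) ((δ hij F).symm b)) ∧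
      -- transfer of membership in the class `Υ`
      (∀ p q : ℕ,
        (𝒦.InUpsilon C₀(↥(unitBall n \ Γ), ℂ) q p ↔ 𝒦.InUpsilon C₀(↥(Γ \ {ω₀}), ℂ) p q) ∧
        (∀ Φ : 𝒦.UpsilonFamily C₀(↥(Γ \ {ω₀}), ℂ) p q,
          ∃ Ψ : 𝒦.UpsilonFamily C₀(↥(unitBall n \ Γ), ℂ) q p,
            ∀ {i j : ZMod 2} (hij : j = i + 1) (hji : i = j + 1) (F : ECAlg.{u} E)
              (a : Fin p → 𝒦.K j F) (b : Fin q → 𝒦.K i F),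
              Ψ.iso hij (C0.tensor ↥(unitBall n \ Γ) F) (b, a) =
                δ hji F (Φ.iso hji (C0.tensor ↥(Γ \ {ω₀}) F) (a, b))) ∧
        (∀ Ψ : 𝒦.UpsilonFamily C₀(↥(unitBall n \ Γ), ℂ) q p,
          ∃ Φ : 𝒦.UpsilonFamily C₀(↥(Γ \ {ω₀}), ℂ) p q,
            ∀ {i j : ZMod 2} (hij : j = i + 1) (hji : i = j + 1) (F : ECAlg.{u} E)
              (a : Fin p → 𝒦.K j F) (b : Fin q → 𝒦.K i F),
              Ψ.iso hij (C0.tensor ↥(unitBall n \ Γ) F) (b, a) =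
                δ hji F (Φ.iso hji (C0.tensor ↥(Γ \ {ω₀}) F) (a, b)))) ∧
      -- finite `Γ`
      (Γ.Finite →
        -- identifications of the groups
        (∀ (i : ZMod 2) (F : ECAlg.{u} E),
          (∃ t : 𝒦.K i (C0 ↥(Γ \ {ω₀}) F) ≃+ (↥(Γ \ {ω₀}) → 𝒦.K i F),
            ∀ c ω, t c ω = 𝒦.map i (C0.eval ω F) c) ∧
          (∃ t : 𝒦.K i (C0 ↥Γ F) ≃+ (↥Γ → 𝒦.K i F), ∀ c ω, t c ω = 𝒦.map i (C0.eval ω F) c) ∧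
          (∃ t : 𝒦.K i F ≃+ 𝒦.K i (C0 ↥(unitBall n) F),
            ∀ a, t a = 𝒦.map i (C0.const (isCompact_unitBall n) F) a)) ∧
        (∀ {i j : ZMod 2} (hij : j = i + 1) (F : ECAlg.{u} E),
          ∃ t : 𝒦.K j (C0 ↥(unitBall n \ Γ) F) ≃+ (↥(Γ \ {ω₀}) → 𝒦.K i F),
            ∀ b ω, t b ω = 𝒦.map i (C0.eval ω F) ((δ hij F).symm b)) ∧
        -- the maps of the split exact sequence under these identifications
        (∀ (i : ZMod 2) (F : ECAlg.{u} E) (a : 𝒦.K i F) (ω : ↥Γ),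
          𝒦.map i (C0.eval ω F) (𝒦.map i (C0.psi13 hΓ hΓB F)
            (𝒦.map i (C0.const (isCompact_unitBall n) F) a)) = a) ∧
        (∀ {i j : ZMod 2} (hij : j = i + 1) (F : ECAlg.{u} E) (c : 𝒦.K i (C0 ↥Γ F))
          (ω : ↥(Γ \ {ω₀})),
          𝒦.map i (C0.eval ω F) ((δ hij F).symm (𝒦.index (h13 F) hij c)) =
            𝒦.map i (C0.eval (⟨ω, ω.2.1⟩ : ↥Γ) F) c - 𝒦.map i (C0.eval (⟨ω₀, hω₀⟩ : ↥Γ) F) c) ∧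
        -- membership in the class `Υ`
        𝒦.InUpsilon C₀(↥(unitBall n \ Γ), ℂ) 0 (Nat.card ↥(Γ \ {ω₀})) ∧
        Nat.card ↥(Γ \ {ω₀}) + 1 = Nat.card ↥Γ ∧
        ∀ e : Fin (Nat.card ↥(Γ \ {ω₀})) ≃ ↥(Γ \ {ω₀}),
          ∃ (Φ : 𝒦.UpsilonFamily C₀(↥(Γ \ {ω₀}), ℂ) (Nat.card ↥(Γ \ {ω₀})) 0)
            (Ψ : 𝒦.UpsilonFamily C₀(↥(unitBall n \ Γ), ℂ) 0 (Nat.card ↥(Γ \ {ω₀}))),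
            ∀ {i j : ZMod 2} (hij : j = i + 1) (hji : i = j + 1) (F : ECAlg.{u} E)
              (a : Fin (Nat.card ↥(Γ \ {ω₀})) → 𝒦.K j F) (b : Fin 0 → 𝒦.K i F),
              (∀ k, 𝒦.map j (C0.eval (e k) F)
                (Φ.iso hji (C0.tensor ↥(Γ \ {ω₀}) F) (a, b)) = a k) ∧
              Ψ.iso hij (C0.tensor ↥(unitBall n \ Γ) F) (b, a) =
                δ hji F (Φ.iso hji (C0.tensor ↥(Γ \ {ω₀}) F) (a, b))) := by
  have hcs : CompactSpace ↥(unitBall n) := isCompact_iff_compactSpace.1 (isCompact_unitBall n)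
  have hconv := convex_unitBall n
  have hω₀B := hΓB hω₀
  have hnull : ∀ (i : ZMod 2) (F : ECAlg.{u} E),
      Subsingleton (𝒦.K i (C0 ↥(unitBall n \ {ω₀}) F)) := fun i F =>
    𝒦.subsingleton_of_homotopic (C0.homotopic_zeroHom_id hconv hω₀B F) i
  have hconst : ∀ (i : ZMod 2) (F : ECAlg.{u} E),
      Function.Bijective (𝒦.map i (C0.const (isCompact_unitBall n) F)) := fun i F =>
    𝒦.map_bijective_of_homotopic (ψ := C0.eval (⟨ω₀, hω₀B⟩ : ↥(unitBall n)) F) rfl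
      (C0.homotopic_eval_const hconv hω₀B _ F) i
  have h13 := C0.shortExact13 (E := E) hΓ hΓB
  have h23 := C0.shortExact23 (E := E) hΓ hΓB hω₀
  let δ : ∀ {i j : ZMod 2}, j = i + 1 → ∀ F : ECAlg.{u} E,
      𝒦.K i (C0 ↥(Γ \ {ω₀}) F) ≃+ 𝒦.K j (C0 ↥(unitBall n \ Γ) F) := fun hij F =>
    AddEquiv.ofBijective (𝒦.index (h23 F) hij)
      (𝒦.index_bijective (h23 F) (fun i => hnull i F) hij)
  have hδ : ∀ {i j : ZMod 2} (hij : j = i + 1) (F : ECAlg.{u} E) c,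
      δ hij F c = 𝒦.index (h23 F) hij c := fun _ _ _ => rfl
  clear_value δ
  have hδnat : ∀ {i j : ZMod 2} (hij : j = i + 1) {F F' : ECAlg.{u} E} (φ : F ⟶ F')
      (c : 𝒦.K i (C0 ↥(Γ \ {ω₀}) F)),
      𝒦.map j (C0.map ↥(unitBall n \ Γ) φ) (δ hij F c) =
        δ hij F' (𝒦.map i (C0.map ↥(Γ \ {ω₀}) φ) c) := fun {i j} hij {F F'} φ c => by
    rw [hδ, hδ]
    exact 𝒦.index_natural (h23 F) (h23 F') _ (C0.map ↥(unitBall n \ {ω₀}) φ) _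
      (C0.phi23_map hΓ hω₀ φ) rfl hij c
  have hδsymm : ∀ {i j : ZMod 2} (hij : j = i + 1) {F F' : ECAlg.{u} E} (φ : F ⟶ F')
      (c : 𝒦.K j (C0 ↥(unitBall n \ Γ) F)),
      𝒦.map i (C0.map ↥(Γ \ {ω₀}) φ) ((δ hij F).symm c) =
        (δ hij F').symm (𝒦.map j (C0.map ↥(unitBall n \ Γ) φ) c) := fun {i j} hij {F F'} φ c => by
    rw [AddEquiv.eq_symm_apply, ← hδnat, AddEquiv.apply_symm_apply]
  -- the index map of the first sequence is inverted by `Φ`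
  have hindex : ∀ {i j : ZMod 2} (hij : j = i + 1) (F : ECAlg.{u} E)
      (b : 𝒦.K j (C0 ↥(unitBall n \ Γ) F)),
      𝒦.index (h13 F) hij (𝒦.map i (C0.phiPoint Γ ω₀ F) ((δ hij F).symm b)) = b := by
    intro i j hij F b
    -- The morphism of exact sequences has the identity as its first component, so its naturality
    -- square says δ₁₃ ∘ K_i(φ) = δ₂₃.
    have h := 𝒦.index_natural (h23 F) (h13 F) (𝟙 _) (C0.phi13 isClosed_singleton F)
      (C0.phiPoint Γ ω₀ F)
      ((C0.phi23_comp_phi13 hΓ hω₀ F).trans (Category.id_comp _).symm)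
      (C0.psi23_comp_phiPoint hΓ hΓB F) hij ((δ hij F).symm b)
    rw [← hδ, AddEquiv.apply_symm_apply] at h
    exact h.symm.trans (𝒦.map_id_apply j b)
  have hevalB : ∀ (i : ZMod 2) (F : ECAlg.{u} E) (a : 𝒦.K i F) (ω : ↥Γ),
      𝒦.map i (C0.eval ω F) (𝒦.map i (C0.psi13 hΓ hΓB F)
        (𝒦.map i (C0.const (isCompact_unitBall n) F) a)) = a := fun i F a ω => by
    rw [← 𝒦.map_comp_apply, ← 𝒦.map_comp_apply]
    exact 𝒦.map_id_apply i a
  have hinj : ∀ (i : ZMod 2) (F : ECAlg.{u} E),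
      Function.Injective (𝒦.map i (C0.psi13 hΓ hΓB F)) := by
    refine fun i F => (injective_iff_map_eq_zero _).2 fun b hb => ?_
    -- Each class on the ball is constant, and evaluation at `ω₀` ∈ Γ recovers it after restriction
    -- to Γ.
    obtain ⟨a, rfl⟩ := (hconst i F).2 b
    have h := hevalB i F a ⟨ω₀, hω₀⟩
    rw [hb] at h
    rw [← h]
    simp only [map_zero]
  have hker : ∀ {i j : ZMod 2} (hij : j = i + 1) (F : ECAlg.{u} E) (c : 𝒦.K i (C0 ↥Γ F)),
      𝒦.index (h13 F) hij c = 0 ↔ ∃ a, 𝒦.map i (C0.psi13 hΓ hΓB F) a = c :=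
    fun hij F c => 𝒦.exact_right (h13 F) hij c
  have hdecomp : ∀ {i j : ZMod 2} (hij : j = i + 1) (F : ECAlg.{u} E) (c : 𝒦.K i (C0 ↥Γ F)),
      ∃ a, 𝒦.map i (C0.psi13 hΓ hΓB F) a + 𝒦.map i (C0.phiPoint Γ ω₀ F)
        ((δ hij F).symm (𝒦.index (h13 F) hij c)) = c := fun {i j} hij F c => by
    -- Subtracting the part of c that `hindex` accounts for leaves a class in the kernel of δ₁₃,
    -- hence one restricted from the ball.
    obtain ⟨a, ha⟩ := (hker hij F (c - 𝒦.map i (C0.phiPoint Γ ω₀ F)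
      ((δ hij F).symm (𝒦.index (h13 F) hij c)))).1 (by rw [map_sub, hindex, sub_self])
    exact ⟨a, by rw [ha, sub_add_cancel]⟩
  have htransfer := fun {p q : ℕ} (Φ : 𝒦.UpsilonFamily C₀(↥(Γ \ {ω₀}), ℂ) p q) =>
    KTheory.UpsilonFamily.exists_transfer δ hδnat Φ
  have htransfer' : ∀ {p q : ℕ} (Ψ : 𝒦.UpsilonFamily C₀(↥(unitBall n \ Γ), ℂ) q p),
      ∃ Φ : 𝒦.UpsilonFamily C₀(↥(Γ \ {ω₀}), ℂ) p q,
        ∀ {i j : ZMod 2} (hij : j = i + 1) (hji : i = j + 1) (F : ECAlg.{u} E)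
          (a : Fin p → 𝒦.K j F) (b : Fin q → 𝒦.K i F),
          Ψ.iso hij (C0.tensor ↥(unitBall n \ Γ) F) (b, a) =
            δ hji F (Φ.iso hji (C0.tensor ↥(Γ \ {ω₀}) F) (a, b)) := fun {p q} Ψ => by
    -- The inverse of `δ` also shifts the degree by one, as -1 = 1 in ℤ/2, so the same transfer
    -- applies in the other direction.
    obtain ⟨Φ, hΦ⟩ := KTheory.UpsilonFamily.exists_transfer
      (fun {i j} hij F => (δ (zmod_two_eq_add_one hij) F).symm)
      (fun {i j} hij {F F'} φ c => hδsymm (zmod_two_eq_add_one hij) φ c) Ψ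
    refine ⟨Φ, fun hij hji F a b => ?_⟩
    rw [hΦ hji hij F b a]
    exact ((δ hji F).apply_symm_apply _).symm
  refine ⟨⟨C0.nullHomotopic_sdiff_singleton hconv hω₀B _, KTheory.upsilonNull_of_subsingleton hnull,
    𝒦.inUpsilonOne_of_bijective (isCompact_unitBall n) hconst,
    fun e he Φ hΦ _ _ _ _ _ h => hΦ.compatible h⟩, h13, h23, δ, hδ,
    fun hij F => ⟨(δ (zmod_two_eq_add_one hij) F).symm⟩, fun {i j} hij F => ⟨hinj i F, hker hij F,
      fun b => ⟨_, hindex hij F b⟩, hindex hij F, ?_⟩,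
    fun p q => ⟨⟨fun ⟨Ψ⟩ => ⟨(htransfer' Ψ).choose⟩, fun ⟨Φ⟩ => ⟨(htransfer Φ).choose⟩⟩,
      htransfer, htransfer'⟩, fun hfin => ?_⟩
  · let s : (𝒦.K i (C0 ↥(unitBall n) F) × 𝒦.K j (C0 ↥(unitBall n \ Γ) F)) →+ 𝒦.K i (C0 ↥Γ F) :=
      (𝒦.map i (C0.psi13 hΓ hΓB F)).coprod
        ((𝒦.map i (C0.phiPoint Γ ω₀ F)).comp (δ hij F).symm.toAddMonoidHom)
    have hs : ∀ a b, s (a, b) = 𝒦.map i (C0.psi13 hΓ hΓB F) a +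
        𝒦.map i (C0.phiPoint Γ ω₀ F) ((δ hij F).symm b) := fun _ _ => rfl
    refine ⟨AddEquiv.ofBijective s ⟨(injective_iff_map_eq_zero _).2 ?_, fun c => ?_⟩, hs⟩
    · rintro ⟨a, b⟩ hab
      rw [hs] at hab
      -- Applying δ₁₃ kills the summand from the ball and returns b, so b = 0; then a = 0 by
      -- injectivity.
      have h := congrArg (𝒦.index (h13 F) hij) hab
      rw [map_add, hindex, (hker hij F _).2 ⟨a, rfl⟩, zero_add, map_zero] at h
      subst h
      rw [map_zero, map_zero, add_zero] at hab
      rw [(injective_iff_map_eq_zero _).1 (hinj i F) a hab]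
      rfl
    · obtain ⟨a, ha⟩ := hdecomp hij F c
      exact ⟨(a, 𝒦.index (h13 F) hij c), ha⟩
  have hfin' : (Γ \ {ω₀}).Finite := hfin.sdiff
  have := hfin'.to_subtype
  have hfamily : ∀ e : Fin (Nat.card ↥(Γ \ {ω₀})) ≃ ↥(Γ \ {ω₀}),
      ∃ Φ : 𝒦.UpsilonFamily C₀(↥(Γ \ {ω₀}), ℂ) (Nat.card ↥(Γ \ {ω₀})) 0,
        ∀ {i j : ZMod 2} (hij : j = i + 1) (F : ECAlg.{u} E)
          (a : Fin (Nat.card ↥(Γ \ {ω₀})) → 𝒦.K i F) (b : Fin 0 → 𝒦.K j F) (k),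
          𝒦.map i (C0.eval (e k) F) (Φ.iso hij (C0.tensor ↥(Γ \ {ω₀}) F) (a, b)) = a k :=
    fun e => 𝒦.exists_upsilonFamily_of_finite hfin' e
  refine ⟨fun i F => ⟨⟨𝒦.evalEquiv i F hfin', fun _ _ => rfl⟩,
    ⟨𝒦.evalEquiv i F hfin, fun _ _ => rfl⟩,
    ⟨AddEquiv.ofBijective _ (hconst i F), fun _ => rfl⟩⟩,
    fun {i j} hij F => ⟨(δ hij F).symm.trans (𝒦.evalEquiv i F hfin'), fun _ _ => rfl⟩, hevalB,
    fun {i j} hij F c ω => ?_, ?_, ?_, fun e => ?_⟩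
  · obtain ⟨a, ha⟩ := hdecomp hij F c
    obtain ⟨a, rfl⟩ := (hconst i F).2 a
    set d := (δ hij F).symm (𝒦.index (h13 F) hij c)
    -- Both evaluations give a on the constant summand. The summand from Γ' contributes its value at
    -- ω, and 0 at `ω₀`, so only that value survives in the difference.
    rw [← ha, map_add, map_add, hevalB, hevalB, ← 𝒦.map_comp_apply, ← 𝒦.map_comp_apply,
      C0.phiPoint_comp_eval, C0.phiPoint_comp_eval_self hω₀, 𝒦.map_zeroHom_apply]
    abel
  · obtain ⟨Φ, -⟩ := hfamily (Finite.equivFin _).symm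
    exact ⟨(htransfer Φ).choose⟩
  · rw [Nat.card_coe_set_eq, Nat.card_coe_set_eq]
    exact Set.ncard_sdiff_singleton_add_one hω₀ hfin
  · obtain ⟨Φ, hΦ⟩ := hfamily e
    obtain ⟨Ψ, hΨ⟩ := htransfer Φ
    exact ⟨Φ, Ψ, fun hij hji F a b => ⟨hΦ hji F a b, hΨ hij hji F a b⟩⟩
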